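/- Let $n\ge 3$ and let $\rho=(\rho_1,\dots,\rho_n)$ satisfy $0<\rho_i<1$ and $\sum_{i=1}^n\rho_i<1$. Let $D\subset\mathbb R$ be any dust-like self-similar set with contraction vector $\rho$, i.e. a nonempty compact set with $D=\bigcup_{i=1}^n\Phi_i(D)$, where $\Phi_i:\mathbb R\to\mathbb R$ is a similitude of ratio $\rho_i$ and the sets $\Phi_1(D),\dots,\Phi_n(D)$ are pairwise disjoint. Let $\Psi_i(x)=\rho_i x+t_i$ $(1\le i\le n)$ be such that $\Psi_i(1)\le\Psi_{i+1}(0)$ for $1\le i<n$, $\Psi_1(0)=0$, $\Psi_n(1)=1$, and $\Psi_i(1)=\Psi_{i+1}(0)$ for at least one $i<n$. Let $T$ be the attractor of $\{\Psi_i\}$, i.e. the nonempty compact set with $T=\bigcup_{i=1}^n\Psi_i(T)$. Call $i\in\{1,\dots,n-1\}$ a touching letter if $\Psi_i(1)=\Psi_{i+1}(0)$, and let $\Sigma_T$ be the set of touching letters. Let $\alpha$ be the largest number such that $1,\dots,\alpha-1\in\Sigma_T$, and $\beta$ the largest number such that $n-\beta+1,\dots,n-1\in\Sigma_T$. For a nonempty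 finite word $\mathbf i=i_1\cdots i_r$ over $\{1,\dots,n\}$ put $T_{\mathbf i}=\Psi_{i_1}\circ\cdots\circ\Psi_{i_r}(T)$, and for an integer $k\ge 0$ put $$L_k(T_{\mathbf i})=\bigcup_{j=1}^{\alpha}T_{\mathbf i[1]^kj},\qquad R_k(T_{\mathbf i})=\bigcup_{j=n-\beta+1}^{n}T_{\mathbf i[n]^kj},$$ where $[\ell]^k$ is the letter $\ell$ repeated $k$ times. A touching letter $i$ is left substitutable if there are a nonempty finite word $\mathbf j$ and integers $k,k'\ge 0$ such that $\operatorname{diam}L_k(T_{i+1})=\operatorname{diam}L_{k'}(T_{i\mathbf j})$ and the last letter of $\mathbf j$ is not in $\{1\}\cup(\Sigma_T+1)$; it is right substitutable if there are a nonempty finite word $\mathbf j$ and integers $k,k'\ge 0$ such that $\operatorname{diam}R_k(T_i)=\operatorname{diam}R_{k'}(T_{(i+1)\mathbf j})$ and the last letter of $\mathbf j$ is not in $\{n\}\cup\Sigma_T$. It is substitutable if it is left or right substitutable. Assume that $\log\rho_1/\log\rho_n\in\mathbb Q$ and that every touching letter is substitutable. Then $D$ and $T$ are Lipschitz equivalent: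 there are a bijection $f:D\to T$ and constants $c,c'>0$ with $c|x-y|\le|f(x)-f(y)|\le c'|x-y|$ for all $x,y\in D$. -/

import Mathlib

namespace TouchingIFS

/-- Two subsets of the line are Lipschitz equivalent if there is a bijection `f` between them with
`c |x - y| ≤ |f x - f y| ≤ c' |x - y|` for some constants `c, c' > 0`. -/
def LipschitzEquivalent (E F : Set ℝ) : Prop :=
  ∃ f : E → F, Function.Bijective f ∧ ∃ c c' : ℝ, 0 < c ∧ 0 < c' ∧
    ∀ x y : E, c * |(x : ℝ) - y| ≤ |(f x : ℝ) - f y| ∧ |(f x : ℝ) - f y| ≤ c' * |(x : ℝ) - y|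

/-- `f` is a similitude of the line with ratio `r`; it may reverse orientation. -/
def IsSimilitude (r : ℝ) (f : ℝ → ℝ) : Prop :=
  ∀ x y : ℝ, |f x - f y| = r * |x - y|

/-- `E` is the attractor of the maps `f i`: the nonempty compact set with `⋃ i, f i (E) = E`. -/
structure IsAttractor {ι : Type*} (f : ι → ℝ → ℝ) (E : Set ℝ) : Prop where
  nonempty : E.Nonempty
  isCompact : IsCompact E
  iUnion_image : ⋃ i, f i '' E = E

/-- Contraction vectors in `ℝ`: all entries lie in `(0, 1)` and their sum is less than `1`. -/
structure IsContractionVector {ι : Type*} [Fintype ι] (ρ : ι → ℝ) : Prop where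
  pos : ∀ i, 0 < ρ i
  lt_one : ∀ i, ρ i < 1
  sum_lt_one : ∑ i, ρ i < 1

/-- The family of all dust-like self-similar subsets of `ℝ` with contraction vector `ρ`: attractors
of similitudes with ratios `ρ i` that satisfy the strong separation condition. -/
def dustLike {ι : Type*} (ρ : ι → ℝ) : Set (Set ℝ) :=
  {E | ∃ φ : ι → ℝ → ℝ, (∀ i, IsSimilitude (ρ i) (φ i)) ∧ IsAttractor φ E ∧
    ∀ i j, i ≠ j → Disjoint (φ i '' E) (φ j '' E)}

/-- The maps `x ↦ ρ i * x + t i`. -/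
def affineMaps {ι : Type*} (ρ t : ι → ℝ) (i : ι) (x : ℝ) : ℝ := ρ i * x + t i

/- Below there are `n = m + 1` letters, the elements of `Fin (m + 1)`. The first letter is `0`, the
last one is `Fin.last m`, and the pairs of consecutive letters are `(i.castSucc, i.succ)` for
`i : Fin m`. A letter that has a successor is thus given by `i : Fin m`. -/

/-- The letter `i` (that is, `i.castSucc`) is a touching letter:
the right endpoint of `ψ i [0,1]` is the left endpoint of the next interval. -/
def IsTouching {m : ℕ} (ψ : Fin (m + 1) → ℝ → ℝ) (i : Fin m) : Prop :=
  ψ i.castSucc 1 = ψ i.succ 0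

/-- The increasing maps `ψ i` send `[0,1]` to intervals which are arranged from left to right
without overlapping, start at `0`, end at `1`, and at least two consecutive ones touch. -/
structure IsTouchingIFS {m : ℕ} (ψ : Fin (m + 1) → ℝ → ℝ) : Prop where
  ordered : ∀ i : Fin m, ψ i.castSucc 1 ≤ ψ i.succ 0
  left_end : ψ 0 0 = 0
  right_end : ψ (Fin.last m) 1 = 1
  exists_touching : ∃ i : Fin m, IsTouching ψ i

/-- The composition `ψ_{i₁} ∘ ⋯ ∘ ψ_{iₖ}` along a word `i₁ ⋯ iₖ`. -/
def wordMap {ι : Type*} (ψ : ι → ℝ → ℝ) : List ι → ℝ → ℝ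
  | [] => id
  | i :: w => ψ i ∘ wordMap ψ w

/-- The cylinder `T_w = ψ_w (T)`. -/
def cylinder {ι : Type*} (ψ : ι → ℝ → ℝ) (T : Set ℝ) (w : List ι) : Set ℝ :=
  wordMap ψ w '' T

/-- The letters `1, …, α` of the maximal initial run of successively touching intervals. -/
def initialBlock {m : ℕ} (ψ : Fin (m + 1) → ℝ → ℝ) : Set (Fin (m + 1)) :=
  {j | ∀ l : Fin m, l.succ ≤ j → IsTouching ψ l}

/-- The letters `n - β + 1, …, n` of the maximal final run of successively touching intervals. -/
def finalBlock {m : ℕ} (ψ : Fin (m + 1) → ℝ → ℝ) : Set (Fin (m + 1)) :=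
  {j | ∀ l : Fin m, j ≤ l.castSucc → IsTouching ψ l}

/-- The level `k + 1` left touching patch `L_k(T_w)`, the union of `T_{w 1^k j}`, `1 ≤ j ≤ α`. -/
def leftPatch {m : ℕ} (ψ : Fin (m + 1) → ℝ → ℝ) (T : Set ℝ) (k : ℕ) (w : List (Fin (m + 1))) :
    Set ℝ :=
  ⋃ j ∈ initialBlock ψ, cylinder ψ T (w ++ List.replicate k 0 ++ [j])

/-- The level `k + 1` right touching patch `R_k(T_w)`, the union of `T_{w n^k j}`,
`n - β + 1 ≤ j ≤ n`. -/
def rightPatch {m : ℕ} (ψ : Fin (m + 1) → ℝ → ℝ) (T : Set ℝ) (k : ℕ) (w : List (Fin (m + 1))) :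
    Set ℝ :=
  ⋃ j ∈ finalBlock ψ, cylinder ψ T (w ++ List.replicate k (Fin.last m) ++ [j])

/-- Left substitutable: `diam L_k(T_{i+1}) = diam L_{k'}(T_{i u})` for some `k, k' ≥ 0` and some
nonempty word `u` whose last letter is neither the first letter nor the successor of a touching
letter. -/
def LeftSubstitutable {m : ℕ} (ψ : Fin (m + 1) → ℝ → ℝ) (T : Set ℝ) (i : Fin m) : Prop :=
  ∃ (u : List (Fin (m + 1))) (hu : u ≠ []) (k k' : ℕ),
    Metric.diam (leftPatch ψ T k [i.succ]) = Metric.diam (leftPatch ψ T k' (i.castSucc :: u)) ∧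
    u.getLast hu ≠ 0 ∧ ∀ l : Fin m, IsTouching ψ l → u.getLast hu ≠ l.succ

/-- Right substitutable: `diam R_k(T_i) = diam R_{k'}(T_{(i+1) u})` for some `k, k' ≥ 0` and some
nonempty word `u` whose last letter is neither the last letter `n` nor a touching letter. -/
def RightSubstitutable {m : ℕ} (ψ : Fin (m + 1) → ℝ → ℝ) (T : Set ℝ) (i : Fin m) : Prop :=
  ∃ (u : List (Fin (m + 1))) (hu : u ≠ []) (k k' : ℕ),
    Metric.diam (rightPatch ψ T k [i.castSucc]) = Metric.diam (rightPatch ψ T k' (i.succ :: u)) ∧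
    u.getLast hu ≠ Fin.last m ∧ ∀ l : Fin m, IsTouching ψ l → u.getLast hu ≠ l.castSucc

/-- A letter is substitutable if it is left or right substitutable. -/
def Substitutable {m : ℕ} (ψ : Fin (m + 1) → ℝ → ℝ) (T : Set ℝ) (i : Fin m) : Prop :=
  LeftSubstitutable ψ T i ∨ RightSubstitutable ψ T i

end TouchingIFS

/-!
Let `D` be dust-like with similitudes `φ_i`, so that every point of `D` has a unique address and
`|φ_w x - φ_w y| = ρ_w |x - y|` for all words `w`. The theorem follows once `T` is the *disjoint*
union of images `g_i(T)` under maps whose compositions satisfy `|g_w x - g_w y| ≍ ρ_w |x - y|`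
uniformly in `w` (`IsBilipCoding`): matching points with equal addresses is then bi-Lipschitz
(`IsBilipCoding.lipschitzEquivalent`).

Call the letters `1, …, n`; in the formal text they are `0, …, Fin.last m`. The affine maps `ψ_i`
themselves fail only because neighboring images may share an end point `x`.
Suppose that `T_i` and `T_{i+1}` touch at `x` and that `i` is left substitutable. Equality of
diameters is the equation `ρ_{i+1} ρ_1^k = ρ_i ρ_u ρ_1^{k'}` between ratios, and `ρ_1^a = ρ_n^b` for
some `a, b ≥ 1` because of the condition on the logarithms. Hence the initial piece `P_p` of `T_{i+1}`
at the word `(i+1) 1^{k+s+ap}` is, for all `p` at the same time, congruent to the piece `Q_p` of `T_i`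
at `i n^{bp} u 1^{k'+s}`. By the condition on the last letter of `u` the piece `Q_p` is surrounded by
gaps that are comparable to its size, and so is the difference of `P_p` and `P_{p+1}`
(`IsIntervalIFS.exists_touchingModel`). Now separate the two parts as in Hilbert's hotel: `P_0` moves
to `Q_0`, and `Q_p` moves to `P_p`, except for the part that would land in `P_{p+1}`, which moves to
`Q_{p+1}` (`TouchingModel.exists_isSeparation`). All these moves are translations, and sizes,
distances and gaps at step `p` are proportional to `ρ_1^{ap}`. So the rearrangement is bi-Lipschitz, with
a constant that does not change when only the steps `p ≥ N` are used, that is, when the moves are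
confined to a tiny neighborhood of `x`. Right substitutable letters are reduced to this case by the
reflection `y ↦ 1 - y`.

The maps `g_i` are the `ψ_i` followed by these moves near the touching ends (`displacedMaps`). For
the compositions the single bi-Lipschitz constants must not accumulate. The map `g_i` scales the
distance of `x` and `y` by exactly `ρ_i` if this distance is small in comparison with the distance
`φ(x)` of `x` from `{0, 1}`, and also if it is less than an absolute constant and `g_i x` is close
to `{0, 1}`. In all other cases `φ(g_i x)` is bounded below, and if `|x - y|` is small, then all
further maps scale the distance exactly. So a
close pair loses a constant only once (`wordMap_distortion_of_close`), and since the moves are tiny,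
every pair becomes close after a bounded number of steps (`wordMap_distortion`).
-/

/-! ### Codings with bounded distortion -/

namespace TouchingIFS

/-- The product of the ratios along a word. -/
def wordRatio {ι : Type*} (ρ : ι → ℝ) (w : List ι) : ℝ := (w.map ρ).prod

section Words

variable {ι : Type*} {ρ : ι → ℝ} {g : ι → ℝ → ℝ} {X : Set ℝ}

@[simp] lemma wordRatio_nil : wordRatio ρ [] = 1 := rfl

@[simp] lemma wordRatio_cons (i : ι) (w : List ι) :
    wordRatio ρ (i :: w) = ρ i * wordRatio ρ w := by
  simp [wordRatio]

lemma wordRatio_append (v w : List ι) :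
    wordRatio ρ (v ++ w) = wordRatio ρ v * wordRatio ρ w := by
  simp [wordRatio]

lemma wordRatio_replicate (k : ℕ) (i : ι) : wordRatio ρ (List.replicate k i) = ρ i ^ k := by
  simp [wordRatio]

lemma wordRatio_pos (hρ : ∀ i, 0 < ρ i) (w : List ι) : 0 < wordRatio ρ w := by
  induction w with
  | nil => simp
  | cons i w ih => simpa using mul_pos (hρ i) ih

lemma wordRatio_le_one (hρ : ∀ i, 0 < ρ i) (hρ' : ∀ i, ρ i < 1) (w : List ι) :
    wordRatio ρ w ≤ 1 := by
  induction w with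
  | nil => simp
  | cons i w ih =>
    simpa using mul_le_one₀ (hρ' i).le (wordRatio_pos hρ w).le ih

@[simp] lemma wordMap_nil (x : ℝ) : wordMap g [] x = x := rfl

@[simp] lemma wordMap_cons (i : ι) (w : List ι) (x : ℝ) :
    wordMap g (i :: w) x = g i (wordMap g w x) := rfl

lemma wordMap_append (v w : List ι) (x : ℝ) :
    wordMap g (v ++ w) x = wordMap g v (wordMap g w x) := by
  induction v with
  | nil => rfl
  | cons i v ih => simp [ih]

lemma wordMap_mem (hg : ∀ i, ∀ x ∈ X, g i x ∈ X) (w : List ι) {x : ℝ} (hx : x ∈ X) :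
    wordMap g w x ∈ X := by
  induction w with
  | nil => exact hx
  | cons i w ih => exact hg i _ ih

lemma IsAttractor.mapsTo (h : IsAttractor g X) (i : ι) : ∀ x ∈ X, g i x ∈ X := fun x hx => by
  rw [← h.iUnion_image]
  exact Set.mem_iUnion.2 ⟨i, x, hx, rfl⟩

lemma IsAttractor.exists_preimage (h : IsAttractor g X) {x : ℝ} (hx : x ∈ X) :
    ∃ i, ∃ y ∈ X, g i y = x := by
  rw [← h.iUnion_image] at hx
  simpa using hx

end Words

/-- The compact set `X` is the disjoint union of its images under the maps `g i`, and the
compositions `g_w` along words distort the ratio `ρ_w` by a bounded factor only. The maps `g i`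
need not be contractions. -/
structure IsBilipCoding {ι : Type*} (ρ : ι → ℝ) (g : ι → ℝ → ℝ) (X : Set ℝ) : Prop where
  isAttractor : IsAttractor g X
  disjoint : ∀ i j, i ≠ j → Disjoint (g i '' X) (g j '' X)
  distortion : ∃ K : ℝ, 0 < K ∧ ∀ w : List ι, ∀ x ∈ X, ∀ y ∈ X,
    wordRatio ρ w * |x - y| ≤ K * |wordMap g w x - wordMap g w y| ∧
      |wordMap g w x - wordMap g w y| ≤ K * (wordRatio ρ w * |x - y|)

namespace IsBilipCoding

variable {ι : Type*} {ρ : ι → ℝ} {g : ι → ℝ → ℝ} {X : Set ℝ}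

lemma continuousOn_wordMap (h : IsBilipCoding ρ g X) (w : List ι) :
    ContinuousOn (wordMap g w) X := by
  obtain ⟨K, -, hK⟩ := h.distortion
  refine LipschitzOnWith.continuousOn (K := (K * wordRatio ρ w).toNNReal)
    (LipschitzOnWith.of_dist_le_mul fun x hx y hy => ?_)
  rw [Real.dist_eq, Real.dist_eq]
  refine (hK w x hx y hy).2.trans ?_
  rw [← mul_assoc]
  exact mul_le_mul_of_nonneg_right (Real.le_coe_toNNReal _) (abs_nonneg _)

lemma exists_separation [Finite ι] (h : IsBilipCoding ρ g X) :
    ∃ c : ℝ, 0 < c ∧ ∀ i j, i ≠ j → ∀ x ∈ X, ∀ y ∈ X, c ≤ |g i x - g j y| := by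
  classical
  cases nonempty_fintype ι
  have hcomp : ∀ i, IsCompact (g i '' X) := fun i =>
    h.isAttractor.isCompact.image_of_continuousOn (h.continuousOn_wordMap [i])
  have hpair : ∀ p : ι × ι, ∃ c : ℝ, 0 < c ∧
      (p.1 ≠ p.2 → ∀ x ∈ X, ∀ y ∈ X, c ≤ |g p.1 x - g p.2 y|) := by
    rintro ⟨i, j⟩
    by_cases hij : i = j
    · exact ⟨1, one_pos, fun hne => absurd hij hne⟩
    obtain ⟨r, hr, hd⟩ := Metric.exists_pos_forall_lt_edist (hcomp i) (hcomp j).isClosed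
      (h.disjoint i j hij)
    refine ⟨r, by exact_mod_cast hr, fun _ x hx y hy => ?_⟩
    have := hd _ ⟨x, hx, rfl⟩ _ ⟨y, hy, rfl⟩
    rw [edist_nndist] at this
    have h2 : r < nndist (g i x) (g j y) := by exact_mod_cast this
    have h3 : (r : ℝ) < dist (g i x) (g j y) := by exact_mod_cast h2
    exact h3.le
  choose c hc hcs using hpair
  obtain ⟨c₀, hc₀, hle⟩ : ∃ c₀ : ℝ, 0 < c₀ ∧ ∀ p, c₀ ≤ c p := by
    rcases isEmpty_or_nonempty (ι × ι) with he | he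
    · exact ⟨1, one_pos, fun p => he.elim p⟩
    · obtain ⟨p₀, hp₀⟩ := Finite.exists_min c
      exact ⟨c p₀, hc p₀, hp₀⟩
  exact ⟨c₀, hc₀, fun i j hij x hx y hy => (hle (i, j)).trans (hcs (i, j) hij x hx y hy)⟩

/-- Every point has an address. -/
lemma exists_address (h : IsBilipCoding ρ g X) {x : ℝ} (hx : x ∈ X) :
    ∃ σ : ℕ → ι, ∀ n, x ∈ wordMap g ((List.range n).map σ) '' X := by
  have hpre : ∀ z : X, ∃ i, ∃ y : X, g i y = z := fun z => by
    obtain ⟨i, y, hy, hyz⟩ := h.isAttractor.exists_preimage z.2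
    exact ⟨i, ⟨y, hy⟩, hyz⟩
  choose a s hs using hpre
  have key : ∀ (n : ℕ) (z : X),
      wordMap g ((List.range n).map fun k => a (s^[k] z)) (s^[n] z) = z := by
    intro n
    induction n with
    | zero => intro z; simp
    | succ n ih =>
      intro z
      rw [List.range_succ_eq_map, List.map_cons, List.map_map, wordMap_cons]
      have := ih (s z)
      simp only [← Function.iterate_succ_apply] at this
      simp only [Function.comp_def, Nat.succ_eq_add_one, this]
      exact hs z
  exact ⟨fun k => a (s^[k] ⟨x, hx⟩), fun n => ⟨_, (s^[n] ⟨x, hx⟩).2, key n ⟨x, hx⟩⟩⟩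

/-- Every address is the address of a point. -/
lemma exists_point (h : IsBilipCoding ρ g X) (σ : ℕ → ι) :
    ∃ x, ∀ n, x ∈ wordMap g ((List.range n).map σ) '' X := by
  have hc : ∀ n, IsCompact (wordMap g ((List.range n).map σ) '' X) := fun n =>
    h.isAttractor.isCompact.image_of_continuousOn (h.continuousOn_wordMap _)
  have := IsCompact.nonempty_iInter_of_sequence_nonempty_isCompact_isClosed
    (fun n => wordMap g ((List.range n).map σ) '' X) (fun n => ?_)
    (fun n => h.isAttractor.nonempty.image _) (hc 0) (fun n => (hc n).isClosed)
  · obtain ⟨x, hx⟩ := this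
    exact ⟨x, Set.mem_iInter.1 hx⟩
  · rintro _ ⟨x, hx, rfl⟩
    rw [List.range_succ, List.map_append, wordMap_append]
    exact ⟨_, h.isAttractor.mapsTo _ x hx, rfl⟩

/-- The distance of two points is comparable to the ratio of the longest common prefix of their
addresses. -/
lemma exists_dist_bounds [Finite ι] (h : IsBilipCoding ρ g X) (hρ : ∀ i, 0 < ρ i) :
    ∃ c C : ℝ, 0 < c ∧ 0 < C ∧ ∀ (w : List ι) (i j : ι), i ≠ j → ∀ x y : ℝ,
      x ∈ wordMap g (w ++ [i]) '' X → y ∈ wordMap g (w ++ [j]) '' X →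
        c * wordRatio ρ w ≤ |x - y| ∧ |x - y| ≤ C * wordRatio ρ w := by
  obtain ⟨K, hK, hd⟩ := h.distortion
  obtain ⟨c, hc, hsep⟩ := h.exists_separation
  obtain ⟨M, hM⟩ := h.isAttractor.isCompact.isBounded.exists_norm_le
  have hM0 : 0 ≤ M := (norm_nonneg _).trans (hM _ h.isAttractor.nonempty.some_mem)
  refine ⟨c / K, K * (2 * M + 1), by positivity, by positivity, ?_⟩
  rintro w i j hij _ _ ⟨x, hx, rfl⟩ ⟨y, hy, rfl⟩
  rw [wordMap_append, wordMap_append]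
  have hx' := h.isAttractor.mapsTo i x hx
  have hy' := h.isAttractor.mapsTo j y hy
  obtain ⟨h1, h2⟩ := hd w _ hx' _ hy'
  have hw := wordRatio_pos hρ w
  constructor
  · rw [div_mul_eq_mul_div, div_le_iff₀ hK]
    have := mul_le_mul_of_nonneg_left (hsep i j hij x hx y hy) hw.le
    calc c * wordRatio ρ w = wordRatio ρ w * c := mul_comm _ _
      _ ≤ _ := this
      _ ≤ _ := h1
      _ = _ := mul_comm _ _
  · refine h2.trans ?_
    have : |g i x - g j y| ≤ 2 * M + 1 := by
      have h3 := hM _ hx'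
      have h4 := hM _ hy'
      rw [Real.norm_eq_abs] at h3 h4
      have := abs_sub (g i x) (g j y)
      linarith
    calc K * (wordRatio ρ w * |g i x - g j y|) ≤ K * (wordRatio ρ w * (2 * M + 1)) := by gcongr
      _ = _ := by ring

lemma exists_address_bijection [Finite ι] (h : IsBilipCoding ρ g X) (hρ : ∀ i, 0 < ρ i)
    (hρ' : ∀ i, ρ i < 1) :
    ∃ F : (ℕ → ι) → X, Function.Bijective F ∧ ∃ c C : ℝ, 0 < c ∧ 0 < C ∧
      ∀ (σ τ : ℕ → ι) (n : ℕ), (∀ k < n, σ k = τ k) → σ n ≠ τ n →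
        c * wordRatio ρ ((List.range n).map σ) ≤ |(F σ : ℝ) - F τ| ∧
          |(F σ : ℝ) - F τ| ≤ C * wordRatio ρ ((List.range n).map σ) := by
  obtain ⟨c, C, hc, hC, hb⟩ := h.exists_dist_bounds hρ
  choose F hF using h.exists_point
  have hFX : ∀ σ, F σ ∈ X := fun σ => by
    obtain ⟨x, hx, hx'⟩ := hF σ 0
    rwa [← hx']
  have hbound : ∀ (σ τ : ℕ → ι) (x y : ℝ) (n : ℕ),
      (∀ n, x ∈ wordMap g ((List.range n).map σ) '' X) →
      (∀ n, y ∈ wordMap g ((List.range n).map τ) '' X) →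
      (∀ k < n, σ k = τ k) → σ n ≠ τ n →
        c * wordRatio ρ ((List.range n).map σ) ≤ |x - y| ∧
          |x - y| ≤ C * wordRatio ρ ((List.range n).map σ) := by
    intro σ τ x y n hx hy hn hne
    have heq : (List.range n).map τ = (List.range n).map σ :=
      List.map_congr_left fun k hk => (hn k (List.mem_range.1 hk)).symm
    have h1 := hx (n + 1)
    have h2 := hy (n + 1)
    rw [List.range_succ, List.map_append, List.map_singleton] at h1 h2
    rw [heq] at h2
    exact hb _ _ _ hne x y h1 h2
  have hfirst : ∀ σ τ : ℕ → ι, σ ≠ τ → ∃ n, (∀ k < n, σ k = τ k) ∧ σ n ≠ τ n := by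
    classical
    intro σ τ hne
    have hex : ∃ n, σ n ≠ τ n := Function.ne_iff.1 hne
    exact ⟨Nat.find hex, fun k hk => not_not.1 (Nat.find_min hex hk), Nat.find_spec hex⟩
  have hpt : ∀ (σ : ℕ → ι) (x y : ℝ),
      (∀ n, x ∈ wordMap g ((List.range n).map σ) '' X) →
      (∀ n, y ∈ wordMap g ((List.range n).map σ) '' X) → x = y := by
    intro σ x y hx hy
    obtain ⟨K, hK, hd⟩ := h.distortion
    obtain ⟨M, hM⟩ := h.isAttractor.isCompact.isBounded.exists_norm_le
    have : Nonempty ι := ⟨σ 0⟩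
    obtain ⟨i₀, hi₀⟩ := Finite.exists_max ρ
    have hpow : ∀ n, wordRatio ρ ((List.range n).map σ) ≤ ρ i₀ ^ n := by
      intro n
      induction n with
      | zero => simp
      | succ n ih =>
        rw [List.range_succ, List.map_append, wordRatio_append, pow_succ]
        simp only [List.map_cons, List.map_nil, wordRatio_cons, wordRatio_nil, mul_one]
        exact mul_le_mul ih (hi₀ _) (hρ _).le (pow_nonneg (hρ _).le _)
    have hle : ∀ n, |x - y| ≤ K * (2 * M) * ρ i₀ ^ n := by
      intro n
      obtain ⟨x', hx', rfl⟩ := hx n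
      obtain ⟨y', hy', rfl⟩ := hy n
      have h3 := hM _ hx'
      have h4 := hM _ hy'
      rw [Real.norm_eq_abs] at h3 h4
      have h5 := abs_sub x' y'
      have h6 : |x' - y'| ≤ 2 * M := by linarith
      refine (hd _ x' hx' y' hy').2.trans ?_
      have h7 := hpow n
      calc K * (wordRatio ρ ((List.range n).map σ) * |x' - y'|)
          ≤ K * (ρ i₀ ^ n * (2 * M)) := by
            refine mul_le_mul_of_nonneg_left ?_ hK.le
            exact mul_le_mul h7 h6 (abs_nonneg _) (pow_nonneg (hρ _).le _)
        _ = _ := by ring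
    have hlim : Filter.Tendsto (fun n : ℕ => K * (2 * M) * ρ i₀ ^ n) Filter.atTop (nhds 0) := by
      simpa using (tendsto_pow_atTop_nhds_zero_of_lt_one (hρ i₀).le (hρ' i₀)).const_mul (K * (2 * M))
    have h0 : |x - y| ≤ 0 := ge_of_tendsto' hlim hle
    exact sub_eq_zero.1 (abs_eq_zero.1 (le_antisymm h0 (abs_nonneg _)))
  refine ⟨fun σ => ⟨F σ, hFX σ⟩, ⟨fun σ τ hστ => ?_, fun x => ?_⟩, c, C, hc, hC,
    fun σ τ n => hbound σ τ _ _ n (hF σ) (hF τ)⟩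
  · by_contra hne
    obtain ⟨n, hn, hn'⟩ := hfirst σ τ hne
    have h1 := (hbound σ τ _ _ n (hF σ) (hF τ) hn hn').1
    have h2 : F σ = F τ := congrArg Subtype.val hστ
    rw [h2, sub_self, abs_zero] at h1
    have := mul_pos hc (wordRatio_pos hρ ((List.range n).map σ))
    linarith
  · obtain ⟨σ, hσ⟩ := h.exists_address x.2
    exact ⟨σ, Subtype.ext (hpt σ _ _ (hF σ) hσ)⟩

/-- Two sets coded with the same ratios are Lipschitz equivalent: match points with the same
address. -/
theorem lipschitzEquivalent [Finite ι] {g' : ι → ℝ → ℝ} {Y : Set ℝ} (h : IsBilipCoding ρ g X)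
    (h' : IsBilipCoding ρ g' Y) (hρ : ∀ i, 0 < ρ i) (hρ' : ∀ i, ρ i < 1) :
    LipschitzEquivalent X Y := by
  obtain ⟨F, hF, c, C, hc, hC, hb⟩ := h.exists_address_bijection hρ hρ'
  obtain ⟨G, hG, c', C', hc', hC', hb'⟩ := h'.exists_address_bijection hρ hρ'
  let e := Equiv.ofBijective F hF
  refine ⟨fun x => G (e.symm x), hG.comp e.symm.bijective, c' / C, C' / c, by positivity,
    by positivity, fun x y => ?_⟩
  obtain ⟨σ, rfl⟩ := hF.2 x
  obtain ⟨τ, rfl⟩ := hF.2 y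
  have he : ∀ σ, e.symm (F σ) = σ := fun σ => e.symm_apply_apply σ
  simp only [he]
  by_cases hne : σ = τ
  · subst hne; simp
  classical
  have hex : ∃ n, σ n ≠ τ n := Function.ne_iff.1 hne
  have hlt : ∀ k < Nat.find hex, σ k = τ k := fun k hk => not_not.1 (Nat.find_min hex hk)
  obtain ⟨h1, h2⟩ := hb σ τ _ hlt (Nat.find_spec hex)
  obtain ⟨h3, h4⟩ := hb' σ τ _ hlt (Nat.find_spec hex)
  set q := wordRatio ρ ((List.range (Nat.find hex)).map σ)
  constructor
  · calc c' / C * |(F σ : ℝ) - F τ| ≤ c' / C * (C * q) := by gcongr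
      _ = c' * q := by field_simp
      _ ≤ _ := h3
  · calc |(G σ : ℝ) - G τ| ≤ C' * q := h4
      _ = C' / c * (c * q) := by field_simp
      _ ≤ _ := by gcongr

end IsBilipCoding

/-- Dust-like sets are coded by their own similitudes, without any distortion. -/
lemma IsBilipCoding.of_similitudes {ι : Type*} {ρ : ι → ℝ} {φ : ι → ℝ → ℝ} {X : Set ℝ}
    (hφ : ∀ i, IsSimilitude (ρ i) (φ i)) (hX : IsAttractor φ X)
    (hd : ∀ i j, i ≠ j → Disjoint (φ i '' X) (φ j '' X)) : IsBilipCoding ρ φ X := by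
  have key : ∀ (w : List ι) (x y : ℝ),
      |wordMap φ w x - wordMap φ w y| = wordRatio ρ w * |x - y| := by
    intro w x y
    induction w with
    | nil => simp
    | cons i w ih => rw [wordMap_cons, wordMap_cons, hφ i, ih, wordRatio_cons, mul_assoc]
  refine ⟨hX, hd, 1, one_pos, fun w x _ y _ => ?_⟩
  rw [key]
  simp

end TouchingIFS

/-! ### Bounded distortion from local information -/

namespace TouchingIFS

section Distortion

variable {ι : Type*} {ρ : ι → ℝ} {g : ι → ℝ → ℝ} {X : Set ℝ}

/-- Points at distance at most `δ` are separated at most once along a word: once a map `g i` has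
failed to scale their distance exactly, they are far from the critical set `{φ = 0}` in comparison
with their distance, and this persists. -/
lemma wordMap_distortion_of_close {φ : ℝ → ℝ} {η c C δ : ℝ} (hρ : ∀ i, 0 < ρ i)
    (hρ' : ∀ i, ρ i < 1) (hg : ∀ i, ∀ x ∈ X, g i x ∈ X) (hη : 0 < η) (hC : 1 ≤ C)
    (hδ : C * δ < η * c)
    (hloc : ∀ i, ∀ x ∈ X, ∀ y ∈ X, |x - y| < η * φ x → |g i x - g i y| = ρ i * |x - y|)
    (hcrit : ∀ i, ∀ x ∈ X, φ (g i x) < c → ρ i * φ x ≤ φ (g i x) ∧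
      ∀ y ∈ X, |x - y| ≤ δ → |g i x - g i y| = ρ i * |x - y|)
    (hbi : ∀ i, ∀ x ∈ X, ∀ y ∈ X, ρ i * |x - y| ≤ C * |g i x - g i y| ∧
      |g i x - g i y| ≤ C * (ρ i * |x - y|))
    {x y : ℝ} (hx : x ∈ X) (hy : y ∈ X) (hxy : |x - y| ≤ δ) (w : List ι) :
    wordRatio ρ w * |x - y| ≤ C * |wordMap g w x - wordMap g w y| ∧
      |wordMap g w x - wordMap g w y| ≤ C * (wordRatio ρ w * |x - y|) := by
  have key : |wordMap g w x - wordMap g w y| = wordRatio ρ w * |x - y| ∨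
      ((wordRatio ρ w * |x - y| ≤ C * |wordMap g w x - wordMap g w y| ∧
        |wordMap g w x - wordMap g w y| ≤ C * (wordRatio ρ w * |x - y|)) ∧
        |wordMap g w x - wordMap g w y| < η * φ (wordMap g w x) ∧
        |wordMap g w x - wordMap g w y| < η * c) := by
    induction w with
    | nil => left; simp
    | cons i w ih =>
      have hz := wordMap_mem hg w hx
      have hz' := wordMap_mem hg w hy
      have hw := wordRatio_pos hρ w
      have hw1 := wordRatio_le_one hρ hρ' w
      simp only [wordMap_cons, wordRatio_cons]
      set z := wordMap g w x
      set z' := wordMap g w y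
      have hi := hρ i
      rcases ih with ih | ⟨⟨ih1, ih2⟩, ih3, ih4⟩
      · have hzδ : |z - z'| ≤ δ := by
          rw [ih]
          exact (mul_le_of_le_one_left (abs_nonneg _) hw1).trans hxy
        by_cases hc : φ (g i z) < c
        · left
          rw [(hcrit i z hz hc).2 z' hz' hzδ, ih, mul_assoc]
        · right
          rw [not_lt] at hc
          obtain ⟨h1, h2⟩ := hbi i z hz z' hz'
          have h3 : |g i z - g i z'| < η * c := by
            refine h2.trans_lt (lt_of_le_of_lt ?_ hδ)
            refine mul_le_mul_of_nonneg_left ?_ (by linarith)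
            exact (mul_le_of_le_one_left (abs_nonneg _) (hρ' i).le).trans hzδ
          rw [ih] at h1 h2
          refine ⟨⟨?_, ?_⟩, h3.trans_le (mul_le_mul_of_nonneg_left hc hη.le), h3⟩
          · rwa [mul_assoc]
          · rwa [mul_assoc]
      · right
        have h1 := hloc i z hz z' hz' ih3
        have h4 : ρ i * |z - z'| ≤ |z - z'| := mul_le_of_le_one_left (abs_nonneg _) (hρ' i).le
        rw [h1]
        refine ⟨⟨?_, ?_⟩, ?_, by linarith⟩
        · have := mul_le_mul_of_nonneg_left ih1 hi.le
          linarith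
        · have := mul_le_mul_of_nonneg_left ih2 hi.le
          linarith
        · by_cases hc : φ (g i z) < c
          · have h2 := (hcrit i z hz hc).1
            have h3 := mul_lt_mul_of_pos_left ih3 hi
            have h5 := mul_le_mul_of_nonneg_left h2 hη.le
            linarith
          · rw [not_lt] at hc
            have := mul_le_mul_of_nonneg_left hc hη.le
            linarith
  rcases key with key | key
  · rw [key]
    have := mul_nonneg (wordRatio_pos hρ w).le (abs_nonneg (x - y))
    exact ⟨le_mul_of_one_le_left this hC, le_mul_of_one_le_left this hC⟩
  · exact key.1

/-- Bi-Lipschitz constants of single maps multiply along a word. -/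
lemma wordMap_distortion_pow {C : ℝ} (hρ : ∀ i, 0 < ρ i)
    (hg : ∀ i, ∀ x ∈ X, g i x ∈ X) (hC : 1 ≤ C)
    (hbi : ∀ i, ∀ x ∈ X, ∀ y ∈ X, ρ i * |x - y| ≤ C * |g i x - g i y| ∧
      |g i x - g i y| ≤ C * (ρ i * |x - y|))
    {x y : ℝ} (hx : x ∈ X) (hy : y ∈ X) (w : List ι) :
    wordRatio ρ w * |x - y| ≤ C ^ w.length * |wordMap g w x - wordMap g w y| ∧
      |wordMap g w x - wordMap g w y| ≤ C ^ w.length * (wordRatio ρ w * |x - y|) := by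
  have hC0 : 0 ≤ C := by linarith
  induction w with
  | nil => simp
  | cons i w ih =>
    have hi := hρ i
    obtain ⟨h1, h2⟩ := hbi i _ (wordMap_mem hg w hx) _ (wordMap_mem hg w hy)
    simp only [wordMap_cons, wordRatio_cons, List.length_cons, pow_succ]
    have hp : 0 ≤ C ^ w.length := pow_nonneg hC0 _
    constructor
    · have h3 := mul_le_mul_of_nonneg_left ih.1 hi.le
      have h4 := mul_le_mul_of_nonneg_left h1 hp
      linarith
    · have h3 := mul_le_mul_of_nonneg_left ih.2 (mul_nonneg hC0 hi.le)
      linarith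

/-- Bounded distortion of all compositions, from local information on the maps `g i`: they are
bi-Lipschitz, they scale distances exactly away from the critical set `{φ = 0}`, also near points
whose image is close to that set, and they contract up to a small error. -/
lemma wordMap_distortion {φ : ℝ → ℝ} {η c C δ R : ℝ} (hρ : ∀ i, 0 < ρ i)
    (hρ' : ∀ i, ρ i < 1) (hR0 : 0 ≤ R) (hR : R < 1) (hX : ∀ x ∈ X, ∀ y ∈ X, |x - y| ≤ 1)
    (hg : ∀ i, ∀ x ∈ X, g i x ∈ X) (hη : 0 < η) (hC : 1 ≤ C) (hδ0 : 0 < δ)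
    (hδ : C * δ < η * c)
    (hloc : ∀ i, ∀ x ∈ X, ∀ y ∈ X, |x - y| < η * φ x → |g i x - g i y| = ρ i * |x - y|)
    (hcrit : ∀ i, ∀ x ∈ X, φ (g i x) < c → ρ i * φ x ≤ φ (g i x) ∧
      ∀ y ∈ X, |x - y| ≤ δ → |g i x - g i y| = ρ i * |x - y|)
    (hbi : ∀ i, ∀ x ∈ X, ∀ y ∈ X, ρ i * |x - y| ≤ C * |g i x - g i y| ∧
      |g i x - g i y| ≤ C * (ρ i * |x - y|))
    (hcontr : ∀ i, ∀ x ∈ X, ∀ y ∈ X, |g i x - g i y| ≤ R * |x - y| + (1 - R) * (δ / 2)) :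
    ∃ K : ℝ, 0 < K ∧ ∀ w : List ι, ∀ x ∈ X, ∀ y ∈ X,
      wordRatio ρ w * |x - y| ≤ K * |wordMap g w x - wordMap g w y| ∧
        |wordMap g w x - wordMap g w y| ≤ K * (wordRatio ρ w * |x - y|) := by
  obtain ⟨N, hN⟩ := exists_pow_lt_of_lt_one (half_pos hδ0) hR
  have hdiam : ∀ w : List ι, ∀ x ∈ X, ∀ y ∈ X,
      |wordMap g w x - wordMap g w y| ≤ R ^ w.length + δ / 2 := by
    intro w x hx y hy
    induction w with
    | nil => simpa using (hX x hx y hy).trans (by linarith)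
    | cons i w ih =>
      refine (hcontr i _ (wordMap_mem hg w hx) _ (wordMap_mem hg w hy)).trans ?_
      rw [List.length_cons, pow_succ]
      have := mul_le_mul_of_nonneg_left ih hR0
      linarith
  have hC0 : 0 < C := by linarith
  refine ⟨C ^ (N + 1), by positivity, fun w x hx y hy => ?_⟩
  rcases lt_or_ge w.length N with hlt | hge
  · obtain ⟨h1, h2⟩ := wordMap_distortion_pow hρ hg hC hbi hx hy w
    have hp : C ^ w.length ≤ C ^ (N + 1) := pow_le_pow_right₀ hC (by omega)
    have := mul_nonneg (wordRatio_pos hρ w).le (abs_nonneg (x - y))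
    exact ⟨h1.trans (mul_le_mul_of_nonneg_right hp (abs_nonneg _)),
      h2.trans (mul_le_mul_of_nonneg_right hp this)⟩
  · -- the innermost `N` letters bring the points within distance `δ`
    obtain ⟨v, u, rfl, hu⟩ : ∃ v u : List ι, w = v ++ u ∧ u.length = N :=
      ⟨w.take (w.length - N), w.drop (w.length - N), (List.take_append_drop _ _).symm, by
        rw [List.length_drop]; omega⟩
    have hclose : |wordMap g u x - wordMap g u y| ≤ δ := by
      have := hdiam u x hx y hy
      rw [hu] at this
      linarith
    obtain ⟨h1, h2⟩ := wordMap_distortion_of_close hρ hρ' hg hη hC hδ hloc hcrit hbi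
      (wordMap_mem hg u hx) (wordMap_mem hg u hy) hclose v
    obtain ⟨h3, h4⟩ := wordMap_distortion_pow hρ hg hC hbi hx hy u
    rw [hu] at h3 h4
    have hv := wordRatio_pos hρ v
    rw [wordRatio_append, wordMap_append, wordMap_append, pow_succ]
    have hp : 0 ≤ C ^ N := pow_nonneg hC0.le _
    constructor
    · have h5 := mul_le_mul_of_nonneg_left h3 hv.le
      have h6 := mul_le_mul_of_nonneg_left h1 hp
      linarith
    · have h5 := mul_le_mul_of_nonneg_left h4 (mul_nonneg hC0.le hv.le)
      linarith

end Distortion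

end TouchingIFS

/-! ### Separating two touching parts -/

namespace TouchingIFS

/-- The displacement `s` moves points `v` of `A` to points `v + s v` of `S`. It is at most `ε` and
vanishes at distance more than `ε` from `a`, it is constant on parts of `A` that are small in
comparison with their distance from `a`, and it changes distances at most by the factor `C`. -/
structure IsDisplacement (S A : Set ℝ) (a η C ε : ℝ) (s : ℝ → ℝ) : Prop where
  small : ∀ v ∈ A, |s v| ≤ ε
  supp : ∀ v ∈ A, s v ≠ 0 → |v - a| ≤ ε
  mem : ∀ v ∈ A, v + s v ∈ S
  loc : ∀ v ∈ A, ∀ v' ∈ A, |v - v'| < η * |v - a| → s v = s v'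
  bilip : ∀ v ∈ A, ∀ v' ∈ A, |v - v'| ≤ C * |v + s v - (v' + s v')| ∧
    |v + s v - (v' + s v')| ≤ C * |v - v'|

/-- The displacements `sl` and `sr` of the parts of `S` to the left and to the right of `a` (the
point `a`, where the parts touch, belongs to both) rearrange the disjoint union of these parts
into `S`. -/
structure IsSeparation (S : Set ℝ) (a η C ε : ℝ) (sl sr : ℝ → ℝ) : Prop where
  left : IsDisplacement S (S ∩ Set.Iic a) a η C ε sl
  right : IsDisplacement S (S ∩ Set.Ici a) a η C ε sr
  disjoint : ∀ v ∈ S ∩ Set.Iic a, ∀ v' ∈ S ∩ Set.Ici a, v + sl v ≠ v' + sr v'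
  cover : ∀ y ∈ S, (∃ v ∈ S ∩ Set.Iic a, v + sl v = y) ∨ ∃ v ∈ S ∩ Set.Ici a, v + sr v = y

/-- A set `S` in which two parts touch at `0`, such that for the scales `R p = κ ^ p * R 0`
the initial piece `S ∩ [0, ℓ * R p]` of the right part is followed by a gap, and the left part
contains a translated copy of this piece that starts at `-D * R p` and is surrounded by gaps. -/
structure TouchingModel (S : Set ℝ) (ℓ γ κ D : ℝ) (R : ℕ → ℝ) : Prop where
  ℓ_pos : 0 < ℓ
  γ_pos : 0 < γ
  κ_pos : 0 < κ
  κ_lt_one : κ < 1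
  D_large : κ * (D + γ) + 2 * (ℓ + γ) ≤ D
  R_pos : ∀ p, 0 < R p
  R_succ : ∀ p, R (p + 1) = κ * R p
  gap_right : ∀ p z, z ∈ S → 0 ≤ z → z < (ℓ + γ) * R p → z ≤ ℓ * R p
  gap_copy : ∀ p z, z - D * R p ∈ S → -(γ * R p) < z → z < (ℓ + γ) * R p → 0 ≤ z ∧ z ≤ ℓ * R p
  copy : ∀ p z, 0 ≤ z → z ≤ ℓ * R p → (z ∈ S ↔ z - D * R p ∈ S)

namespace TouchingModel

variable {S : Set ℝ} {ℓ γ κ D : ℝ} {R : ℕ → ℝ}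

/-- The zone `[-D * R p, -D * R p + ℓ * R p]` of the copy at scale `p`. -/
def InCopy (ℓ D : ℝ) (R : ℕ → ℝ) (p : ℕ) (z : ℝ) : Prop :=
  0 ≤ z + D * R p ∧ z + D * R p ≤ ℓ * R p

lemma shift (h : TouchingModel S ℓ γ κ D R) (N : ℕ) :
    TouchingModel S ℓ γ κ D (fun p => R (p + N)) where
  ℓ_pos := h.ℓ_pos
  γ_pos := h.γ_pos
  κ_pos := h.κ_pos
  κ_lt_one := h.κ_lt_one
  D_large := h.D_large
  R_pos p := h.R_pos _
  R_succ p := by rw [← h.R_succ, Nat.succ_add_eq_add_succ]; rfl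
  gap_right p := h.gap_right _
  gap_copy p := h.gap_copy _
  copy p := h.copy _

lemma D_ge (h : TouchingModel S ℓ γ κ D R) : 2 * (ℓ + γ) ≤ D := by
  have h1 := h.D_large
  have := h.ℓ_pos
  have := h.γ_pos
  have := h.κ_pos
  by_contra hlt
  have h2 : 0 ≤ D + γ ∨ D + γ < 0 := le_or_gt _ _
  rcases h2 with h2 | h2
  · nlinarith
  · have h3 := h.κ_lt_one
    nlinarith

lemma R_le (h : TouchingModel S ℓ γ κ D R) {p q : ℕ} (hpq : p ≤ q) : R q ≤ R p := by
  refine antitone_nat_of_succ_le (fun n => ?_) hpq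
  rw [h.R_succ]
  exact mul_le_of_le_one_left (h.R_pos n).le h.κ_lt_one.le

lemma R_eq (h : TouchingModel S ℓ γ κ D R) (p : ℕ) : R p = κ ^ p * R 0 := by
  induction p with
  | zero => simp
  | succ p ih => rw [h.R_succ, ih, pow_succ]; ring

lemma inCopy_bounds (h : TouchingModel S ℓ γ κ D R) {p : ℕ} {z : ℝ} (hz : InCopy ℓ D R p z) :
    z < 0 ∧ |z| ≤ D * R p ∧ D * R p ≤ 2 * |z| := by
  obtain ⟨h1, h2⟩ := hz
  have hR := h.R_pos p
  have h3 := mul_le_mul_of_nonneg_right h.D_ge hR.le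
  have h4 := mul_pos h.γ_pos hR
  have h5 := mul_pos h.ℓ_pos hR
  have hz : z < 0 := by linarith
  rw [abs_of_neg hz]
  exact ⟨hz, by linarith, by linarith⟩

lemma inCopy_unique (h : TouchingModel S ℓ γ κ D R) {p q : ℕ} {z : ℝ} (hp : InCopy ℓ D R p z)
    (hq : InCopy ℓ D R q z) : p = q := by
  have key : ∀ p q : ℕ, p < q → InCopy ℓ D R p z → ¬ InCopy ℓ D R q z := by
    intro p q hpq hp hq
    have hR := h.R_pos p
    have h1 : R q ≤ κ * R p := by
      rw [← h.R_succ]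
      exact h.R_le hpq
    have hγ := h.γ_pos
    have hD : 0 ≤ D := by linarith [h.D_ge, h.ℓ_pos]
    have h2 := mul_le_mul_of_nonneg_left h1 hD
    have h3 := mul_le_mul_of_nonneg_right h.D_large hR.le
    have h4 := mul_pos (mul_pos h.κ_pos hγ) hR
    have h5 := mul_pos h.ℓ_pos hR
    have h6 := mul_pos hγ hR
    have h7 := hp.2
    have h8 := hq.1
    linarith
  rcases lt_trichotomy p q with hlt | heq | hgt
  · exact absurd hq (key p q hlt hp)
  · exact heq
  · exact absurd hp (key q p hgt hq)

lemma inCopy_of_close (h : TouchingModel S ℓ γ κ D R) {p : ℕ} {z z' : ℝ}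
    (hz : InCopy ℓ D R p z) (hz' : z' ∈ S) (hd : |z - z'| < γ * R p) : InCopy ℓ D R p z' := by
  obtain ⟨h1, h2⟩ := abs_lt.1 hd
  refine h.gap_copy p (z' + D * R p) (by simpa using hz') ?_ ?_
  · linarith [hz.1]
  · linarith [hz.2]

variable (ℓ D R) in
/-- The displacement of the left part: the copy at scale `p` is translated to the initial piece
`[0, ℓ * R p]` of the right part, except for the points that come to lie in the smaller initial
piece `[0, ℓ * R (p + 1)]`; these are translated to the next copy. -/
def IsLeftDisplacement (s : ℝ → ℝ) : Prop :=
  ∀ z, (∀ p, InCopy ℓ D R p z → z + D * R p ≤ ℓ * R (p + 1) → s z = D * R p - D * R (p + 1)) ∧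
    (∀ p, InCopy ℓ D R p z → ℓ * R (p + 1) < z + D * R p → s z = D * R p) ∧
    ((∀ p, ¬ InCopy ℓ D R p z) → s z = 0)

lemma exists_isLeftDisplacement (h : TouchingModel S ℓ γ κ D R) :
    ∃ s, IsLeftDisplacement ℓ D R s := by
  have : ∀ z, ∃ t : ℝ,
      (∀ p, InCopy ℓ D R p z → z + D * R p ≤ ℓ * R (p + 1) → t = D * R p - D * R (p + 1)) ∧
      (∀ p, InCopy ℓ D R p z → ℓ * R (p + 1) < z + D * R p → t = D * R p) ∧
      ((∀ p, ¬ InCopy ℓ D R p z) → t = 0) := by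
    intro z
    by_cases hz : ∃ p, InCopy ℓ D R p z
    · obtain ⟨p, hp⟩ := hz
      rcases le_or_gt (z + D * R p) (ℓ * R (p + 1)) with hle | hgt
      · refine ⟨D * R p - D * R (p + 1), fun q hq _ => ?_, fun q hq hlt => ?_, fun hn => ?_⟩
        · rw [h.inCopy_unique hq hp]
        · rw [h.inCopy_unique hq hp] at hlt
          exact absurd hle (not_le.2 hlt)
        · exact absurd hp (hn p)
      · refine ⟨D * R p, fun q hq hlt => ?_, fun q hq _ => ?_, fun hn => ?_⟩
        · rw [h.inCopy_unique hq hp] at hlt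
          exact absurd hgt (not_lt.2 hlt)
        · rw [h.inCopy_unique hq hp]
        · exact absurd hp (hn p)
    · rw [not_exists] at hz
      exact ⟨0, fun p hp => absurd hp (hz p), fun p hp => absurd hp (hz p), fun _ => rfl⟩
  choose s hs using this
  exact ⟨s, hs⟩

/-- The three kinds of points of the left part, with their images `z + s z`. -/
lemma left_cases (h : TouchingModel S ℓ γ κ D R) {s : ℝ → ℝ} (hs : IsLeftDisplacement ℓ D R s)
    {z : ℝ} (hz : z ∈ S) :
    (∃ p, InCopy ℓ D R p z ∧ InCopy ℓ D R (p + 1) (z + s z) ∧ z + s z ∈ S ∧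
      s z = D * R p - D * R (p + 1)) ∨
    (∃ p, InCopy ℓ D R p z ∧ z + s z ∈ S ∧ s z = D * R p ∧ (ℓ + γ) * R (p + 1) ≤ z + s z ∧
      z + s z ≤ ℓ * R p) ∨
    ((∀ p, ¬ InCopy ℓ D R p z) ∧ s z = 0) := by
  by_cases hc : ∃ p, InCopy ℓ D R p z
  · obtain ⟨p, hp⟩ := hc
    have hu : z + D * R p ∈ S := by
      rw [h.copy p _ hp.1 hp.2]
      simpa using hz
    rcases le_or_gt (z + D * R p) (ℓ * R (p + 1)) with hle | hgt
    · left
      have hsz := (hs z).1 p hp hle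
      have heq : z + s z = z + D * R p - D * R (p + 1) := by rw [hsz]; ring
      refine ⟨p, hp, ?_, ?_, hsz⟩
      · rw [heq]
        exact ⟨by simpa using hp.1, by simpa using hle⟩
      · rw [heq, ← h.copy (p + 1) _ hp.1 hle]
        exact hu
    · right; left
      have hsz := (hs z).2.1 p hp hgt
      rw [hsz]
      refine ⟨p, hp, hu, rfl, ?_, hp.2⟩
      by_contra hlt
      rw [not_le] at hlt
      exact absurd (h.gap_right (p + 1) _ hu hp.1 hlt) (not_le.2 hgt)
  · rw [not_exists] at hc
    exact Or.inr (Or.inr ⟨hc, (hs z).2.2 hc⟩)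

lemma left_const_of_inCopy (h : TouchingModel S ℓ γ κ D R) {s : ℝ → ℝ}
    (hs : IsLeftDisplacement ℓ D R s) {p : ℕ} {z z' : ℝ} (hzc : InCopy ℓ D R p z) (hz : z ∈ S)
    (hz' : z' ∈ S) (hd : |z - z'| < γ * R (p + 1)) : s z = s z' := by
  have hR : R (p + 1) ≤ R p := h.R_le (Nat.le_succ p)
  have hzc' : InCopy ℓ D R p z' :=
    h.inCopy_of_close hzc hz' (hd.trans_le (mul_le_mul_of_nonneg_left hR h.γ_pos.le))
  have hu : z + D * R p ∈ S := by
    rw [h.copy p _ hzc.1 hzc.2]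
    simpa using hz
  have hu' : z' + D * R p ∈ S := by
    rw [h.copy p _ hzc'.1 hzc'.2]
    simpa using hz'
  obtain ⟨h1, h2⟩ := abs_lt.1 hd
  rcases le_or_gt (z + D * R p) (ℓ * R (p + 1)) with hle | hgt
  · have hle' := h.gap_right (p + 1) _ hu' hzc'.1 (by linarith)
    rw [(hs z).1 p hzc hle, (hs z').1 p hzc' hle']
  · have hgt' : ℓ * R (p + 1) < z' + D * R p := by
      by_contra hle'
      rw [not_lt] at hle'
      exact absurd (h.gap_right (p + 1) _ hu hzc.1 (by linarith)) (not_le.2 hgt)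
    rw [(hs z).2.1 p hzc hgt, (hs z').2.1 p hzc' hgt']

lemma D_pos (h : TouchingModel S ℓ γ κ D R) : 0 < D := by
  linarith [h.D_ge, h.ℓ_pos, h.γ_pos]

/-- The constants are chosen such that a relative distance less than `η` stays within the gaps. -/
lemma η_bounds (h : TouchingModel S ℓ γ κ D R) :
    0 < γ * κ / (2 * D) ∧ γ * κ / (2 * D) ≤ 1 / 4 ∧
      ∀ p, γ * κ / (2 * D) * (2 * (D * R p)) = γ * R (p + 1) := by
  have hD := h.D_pos
  have hγ := h.γ_pos
  have hκ := h.κ_pos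
  refine ⟨by positivity, ?_, fun p => ?_⟩
  · rw [div_le_iff₀ (by positivity)]
    have h1 : γ * κ ≤ γ := mul_le_of_le_one_right hγ.le h.κ_lt_one.le
    linarith [h.D_ge, h.ℓ_pos]
  · rw [h.R_succ]
    field_simp

lemma left_loc (h : TouchingModel S ℓ γ κ D R) {s : ℝ → ℝ}
    (hs : IsLeftDisplacement ℓ D R s) {z z' : ℝ} (hz : z ∈ S) (hz' : z' ∈ S)
    (hd : |z - z'| < γ * κ / (2 * D) * |z|) : s z = s z' := by
  obtain ⟨h0, h1, h2⟩ := h.η_bounds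
  set η := γ * κ / (2 * D)
  by_cases hc : ∃ p, InCopy ℓ D R p z
  · obtain ⟨p, hp⟩ := hc
    refine h.left_const_of_inCopy hs hp hz hz' (hd.trans_le ?_)
    rw [← h2]
    obtain ⟨-, h3, -⟩ := h.inCopy_bounds hp
    refine mul_le_mul_of_nonneg_left ?_ h0.le
    linarith [abs_nonneg z]
  by_cases hc' : ∃ p, InCopy ℓ D R p z'
  · obtain ⟨p, hp⟩ := hc'
    refine (h.left_const_of_inCopy hs hp hz' hz ?_).symm
    rw [abs_sub_comm]
    refine hd.trans_le ?_
    rw [← h2]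
    obtain ⟨-, h3, -⟩ := h.inCopy_bounds hp
    refine mul_le_mul_of_nonneg_left ?_ h0.le
    have h4 := mul_le_mul_of_nonneg_right h1 (abs_nonneg z)
    have h5 := abs_sub_abs_le_abs_sub z z'
    linarith [abs_nonneg z']
  · rw [not_exists] at hc hc'
    rw [(hs z).2.2 hc, (hs z').2.2 hc']

/-- The translations are also determined by the images: these lie in pieces that are separated by
gaps proportional to their distance from `0`. -/
lemma left_loc_image (h : TouchingModel S ℓ γ κ D R) {s : ℝ → ℝ}
    (hs : IsLeftDisplacement ℓ D R s) {z z' : ℝ} (hz : z ∈ S) (hz0 : z ≤ 0) (hz' : z' ∈ S)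
    (hz0' : z' ≤ 0)
    (hd : |z + s z - (z' + s z')| < γ * κ / (2 * D) * |z + s z|) : s z = s z' := by
  obtain ⟨h0, h1, h2⟩ := h.η_bounds
  set η := γ * κ / (2 * D)
  have hη := mul_le_mul_of_nonneg_right h1 (abs_nonneg (z + s z))
  have hℓ := h.ℓ_pos
  have hγ := h.γ_pos
  have hpos : ∀ p, 0 < (ℓ + γ) * R (p + 1) := fun p => mul_pos (by linarith) (h.R_pos _)
  rcases h.left_cases hs hz with ⟨p, hp, hp1, hpS, hpe⟩ | ⟨p, hp, hpS, hpe, hpl, hpu⟩ | ⟨hn, hn0⟩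
  · obtain ⟨h3, h4, h5⟩ := h.inCopy_bounds hp1
    have hclose : |z + s z - (z' + s z')| < γ * R (p + 1) := by
      refine hd.trans_le ?_
      have h6 : γ * R (p + 1 + 1) ≤ γ * R (p + 1) :=
        mul_le_mul_of_nonneg_left (h.R_le (Nat.le_succ _)) hγ.le
      refine le_trans ?_ h6
      rw [← h2]
      refine mul_le_mul_of_nonneg_left ?_ h0.le
      linarith [abs_nonneg (z + s z)]
    rcases h.left_cases hs hz' with ⟨q, hq, hq1, hqS, hqe⟩ | ⟨q, hq, hqS, hqe, hql, hqu⟩ | ⟨hn, hn0⟩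
    · have := h.inCopy_unique (h.inCopy_of_close hp1 hqS hclose) hq1
      rw [hpe, hqe, Nat.succ_injective this]
    · exfalso
      have := hpos q
      have h6 := abs_sub_comm (z + s z) (z' + s z')
      have h7 := le_abs_self (z' + s z' - (z + s z))
      rw [abs_of_neg h3] at hd hη
      linarith
    · rw [hn0, add_zero] at hclose
      exact absurd (h.inCopy_of_close hp1 hz' hclose) (hn _)
  · have h3 : 0 < z + s z := (hpos p).trans_le hpl
    rw [abs_of_pos h3] at hd hη
    have hsmall : η * (z + s z) ≤ γ * R (p + 1) := by
      rw [← h2]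
      refine mul_le_mul_of_nonneg_left ?_ h0.le
      have := mul_le_mul_of_nonneg_right h.D_ge (h.R_pos p).le
      have := mul_pos hγ (h.R_pos p)
      linarith
    obtain ⟨h4, h5⟩ := abs_lt.1 hd
    rcases h.left_cases hs hz' with ⟨q, hq, hq1, hqS, hqe⟩ | ⟨q, hq, hqS, hqe, hql, hqu⟩ | ⟨hn, hn0⟩
    · exfalso
      have := (h.inCopy_bounds hq1).1
      linarith
    · rcases lt_trichotomy p q with hlt | heq | hgt
      · exfalso
        have := mul_le_mul_of_nonneg_left (h.R_le (Nat.succ_le_of_lt hlt)) hℓ.le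
        rw [Nat.succ_eq_add_one] at this
        linarith
      · rw [hpe, hqe, heq]
      · exfalso
        have h6 := mul_le_mul_of_nonneg_left (h.R_le (Nat.succ_le_of_lt hgt)) hℓ.le
        have h7 := mul_le_mul_of_nonneg_left (h.R_le (hgt.le.trans (Nat.le_succ p))) hγ.le
        have h8 := mul_le_mul_of_nonneg_left (h.R_le (Nat.succ_le_of_lt hgt)) hγ.le
        have h9 := mul_le_mul_of_nonneg_left (h.R_le (Nat.le_succ p)) hγ.le
        rw [Nat.succ_eq_add_one] at h6 h7 h8 h9
        linarith
    · exfalso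
      rw [hn0] at h4 h5
      linarith
  · rw [hn0, add_zero] at hd hη
    rcases h.left_cases hs hz' with ⟨q, hq, hq1, hqS, hqe⟩ | ⟨q, hq, hqS, hqe, hql, hqu⟩ | ⟨hn', hn0'⟩
    · exfalso
      refine hn (q + 1) (h.inCopy_of_close hq1 hz ?_)
      obtain ⟨h3, h4, h5⟩ := h.inCopy_bounds hq1
      rw [abs_sub_comm]
      refine hd.trans_le ?_
      have h6 : γ * R (q + 1 + 1) ≤ γ * R (q + 1) :=
        mul_le_mul_of_nonneg_left (h.R_le (Nat.le_succ _)) hγ.le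
      refine le_trans ?_ h6
      rw [← h2]
      refine mul_le_mul_of_nonneg_left ?_ h0.le
      have h5 := abs_sub_abs_le_abs_sub z (z' + s z')
      linarith [abs_nonneg (z' + s z')]
    · exfalso
      have := hpos q
      have h6 := abs_sub_comm z (z' + s z')
      have h7 := le_abs_self (z' + s z' - z)
      rw [abs_of_nonpos hz0] at hd hη
      linarith
    · rw [hn0, hn0']

lemma left_abs_le (h : TouchingModel S ℓ γ κ D R) {s : ℝ → ℝ}
    (hs : IsLeftDisplacement ℓ D R s) {z : ℝ} (hz : z ∈ S) :
    |s z| ≤ 2 * |z| ∧ |z| ≤ D / (ℓ * κ) * |z + s z| ∧ |s z| ≤ D * R 0 ∧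
      (s z ≠ 0 → |z| ≤ D * R 0) := by
  have hD := h.D_pos
  have hℓ := h.ℓ_pos
  have hκ := h.κ_pos
  have hγ := h.γ_pos
  have hDℓ : 2 ≤ D / ℓ := by
    rw [le_div_iff₀ hℓ]
    linarith [h.D_ge]
  have hR0 : ∀ p, D * R p ≤ D * R 0 := fun p =>
    mul_le_mul_of_nonneg_left (h.R_le (Nat.zero_le p)) hD.le
  rcases h.left_cases hs hz with ⟨p, hp, hp1, hpS, hpe⟩ | ⟨p, hp, hpS, hpe, hpl, hpu⟩ | ⟨hn, hn0⟩
  · obtain ⟨h1, h2, h3⟩ := h.inCopy_bounds hp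
    obtain ⟨h4, h5, h6⟩ := h.inCopy_bounds hp1
    have h7 : D * R (p + 1) ≤ D * R p := mul_le_mul_of_nonneg_left (h.R_le (Nat.le_succ p)) hD.le
    have h8 : 0 < D * R (p + 1) := mul_pos hD (h.R_pos _)
    have h9 : |s z| ≤ D * R p := by
      rw [hpe, abs_of_nonneg (by linarith)]
      linarith
    refine ⟨by linarith, ?_, h9.trans (hR0 p), fun _ => h2.trans (hR0 p)⟩
    rw [h.R_succ] at h6
    have h10 : D * R p ≤ 2 / κ * |z + s z| := by
      rw [div_mul_eq_mul_div, le_div_iff₀ hκ]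
      linarith
    have h11 : 2 / κ ≤ D / (ℓ * κ) := by
      rw [← div_div]
      gcongr
    exact h2.trans (h10.trans (mul_le_mul_of_nonneg_right h11 (abs_nonneg _)))
  · obtain ⟨h1, h2, h3⟩ := h.inCopy_bounds hp
    have h8 : 0 < D * R p := mul_pos hD (h.R_pos _)
    have h9 : |s z| ≤ D * R p := by
      rw [hpe, abs_of_pos h8]
    refine ⟨by linarith, ?_, h9.trans (hR0 p), fun _ => h2.trans (hR0 p)⟩
    refine h2.trans ?_
    rw [div_mul_eq_mul_div, le_div_iff₀ (by positivity)]
    have h10 : ℓ * κ * R p ≤ |z + s z| := by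
      refine le_trans ?_ (le_abs_self _)
      refine le_trans ?_ hpl
      rw [h.R_succ]
      have := mul_pos hγ (mul_pos hκ (h.R_pos p))
      linarith
    have := mul_le_mul_of_nonneg_left h10 hD.le
    linarith
  · rw [hn0]
    refine ⟨by simp, ?_, by simpa using (mul_pos hD (h.R_pos 0)).le, fun h => absurd rfl h⟩
    rw [add_zero]
    refine le_mul_of_one_le_left (abs_nonneg _) ?_
    rw [← div_div, le_div_iff₀ hκ]
    linarith [h.κ_lt_one]

/-- The bi-Lipschitz constant of the rearrangement. It does not depend on the scale. -/
noncomputable def bilipConst (ℓ γ κ D : ℝ) : ℝ :=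
  1 + D / γ + (6 + 2 * (D / (ℓ * κ))) / (γ * κ / (2 * D))

lemma left_bilip (h : TouchingModel S ℓ γ κ D R) {s : ℝ → ℝ}
    (hs : IsLeftDisplacement ℓ D R s) {z z' : ℝ} (hz : z ∈ S) (hz0 : z ≤ 0) (hz' : z' ∈ S)
    (hz0' : z' ≤ 0) :
    |z - z'| ≤ bilipConst ℓ γ κ D * |z + s z - (z' + s z')| ∧
      |z + s z - (z' + s z')| ≤ bilipConst ℓ γ κ D * |z - z'| := by
  have hD := h.D_pos
  have hℓ := h.ℓ_pos
  have hκ := h.κ_pos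
  have hγ := h.γ_pos
  have hη := h.η_bounds.1
  unfold bilipConst
  have hl := fun hd => h.left_loc hs hz hz' hd
  have hl' := fun hd => h.left_loc hs hz' hz hd
  have hi := fun hd => h.left_loc_image hs hz hz0 hz' hz0' hd
  have hi' := fun hd => h.left_loc_image hs hz' hz0' hz hz0 hd
  obtain ⟨a1, a2, -⟩ := h.left_abs_le hs hz
  obtain ⟨b1, b2, -⟩ := h.left_abs_le hs hz'
  set η := γ * κ / (2 * D)
  set E := D / (ℓ * κ) with hE
  have hE0 : 0 < E := by positivity
  have hDγ : 0 < D / γ := by positivity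
  by_cases heq : s z = s z'
  · have : z + s z - (z' + s z') = z - z' := by rw [heq]; ring
    rw [this]
    have hone : 1 ≤ 1 + D / γ + (6 + 2 * E) / η := by
      have : 0 < (6 + 2 * E) / η := by positivity
      linarith
    exact ⟨le_mul_of_one_le_left (abs_nonneg _) hone, le_mul_of_one_le_left (abs_nonneg _) hone⟩
  have key : ∀ a b : ℝ, 0 ≤ b → η * a ≤ (6 + 2 * E) * b →
      a ≤ (1 + D / γ + (6 + 2 * E) / η) * b := by
    intro a b hb hab
    have h1 : a ≤ (6 + 2 * E) / η * b := by
      rw [div_mul_eq_mul_div, le_div_iff₀ hη]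
      linarith
    have h2 := mul_nonneg hDγ.le hb
    linarith
  have hlz : η * |z| ≤ |z - z'| := le_of_not_gt fun hd => heq (hl hd)
  have hlz' : η * |z'| ≤ |z - z'| := by
    rw [abs_sub_comm]
    exact le_of_not_gt fun hd => heq (hl' hd).symm
  have hiz : η * |z + s z| ≤ |z + s z - (z' + s z')| := le_of_not_gt fun hd => heq (hi hd)
  have hiz' : η * |z' + s z'| ≤ |z + s z - (z' + s z')| := by
    rw [abs_sub_comm]
    exact le_of_not_gt fun hd => heq (hi' hd).symm
  constructor
  · refine key _ _ (abs_nonneg _) ?_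
    have h1 := mul_le_mul_of_nonneg_left (abs_sub z z') hη.le
    have h2 := mul_le_mul_of_nonneg_left a2 hη.le
    have h3 := mul_le_mul_of_nonneg_left b2 hη.le
    have h4 := mul_le_mul_of_nonneg_left hiz hE0.le
    have h5 := mul_le_mul_of_nonneg_left hiz' hE0.le
    have h6 := abs_nonneg (z + s z - (z' + s z'))
    linarith
  · refine key _ _ (abs_nonneg _) ?_
    have h1 := abs_sub (z + s z) (z' + s z')
    have h2 := abs_add_le z (s z)
    have h3 := abs_add_le z' (s z')
    have h4 : |z + s z - (z' + s z')| ≤ 3 * |z| + 3 * |z'| := by linarith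
    have h5 := mul_le_mul_of_nonneg_left h4 hη.le
    have h6 := mul_nonneg hE0.le (abs_nonneg (z - z'))
    linarith

/-- The parts of `S` on the two sides of `0` are separated as in Hilbert's hotel: the initial piece
of the right part moves to its copy at scale `0`, and the copy at scale `p` makes room by moving
to where the initial piece at scale `p` was, except for its points that land in the initial piece
at scale `p + 1`, which move to the copy at scale `p + 1`. -/
lemma exists_isSeparation (h : TouchingModel S ℓ γ κ D R) :
    ∃ sl sr, IsSeparation S 0 (γ * κ / (2 * D)) (bilipConst ℓ γ κ D) (D * R 0) sl sr := by
  obtain ⟨s, hs⟩ := h.exists_isLeftDisplacement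
  have hD := h.D_pos
  have hℓ := h.ℓ_pos
  have hκ := h.κ_pos
  have hγ := h.γ_pos
  have hR := h.R_pos 0
  have hDR := mul_pos hD hR
  have hγR := mul_pos hγ hR
  obtain ⟨hη, hη4, hηR⟩ := h.η_bounds
  have hDge := mul_le_mul_of_nonneg_right h.D_ge hR.le
  set t : ℝ → ℝ := fun z => if z ≤ ℓ * R 0 then -(D * R 0) else 0 with ht
  have ht1 : ∀ z, z ≤ ℓ * R 0 → t z = -(D * R 0) := fun z hz => if_pos hz
  have ht2 : ∀ z, ℓ * R 0 < z → t z = 0 := fun z hz => if_neg (not_le.2 hz)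
  have hgap : ∀ z ∈ S, ℓ * R 0 < z → (ℓ + γ) * R 0 ≤ z := fun z hz hlt => by
    by_contra hn
    rw [not_le] at hn
    have := mul_pos hℓ hR
    exact absurd (h.gap_right 0 z hz (by linarith) hn) (not_le.2 hlt)
  have hone : 1 + D / γ ≤ bilipConst ℓ γ κ D := by
    unfold bilipConst
    have : 0 < (6 + 2 * (D / (ℓ * κ))) / (γ * κ / (2 * D)) := by positivity
    linarith
  have hDγ : 0 < D / γ := by positivity
  have himg : ∀ z ∈ S, 0 ≤ z → (InCopy ℓ D R 0 (z + t z) ∧ z + t z ∈ S ∧ z ≤ ℓ * R 0) ∨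
      (ℓ * R 0 < z ∧ t z = 0) := by
    intro z hz hz0
    rcases le_or_gt z (ℓ * R 0) with hle | hgt
    · left
      rw [ht1 z hle]
      refine ⟨⟨by simpa using hz0, by simpa using hle⟩, ?_, hle⟩
      rw [← sub_eq_add_neg, ← h.copy 0 z hz0 hle]
      exact hz
    · exact Or.inr ⟨hgt, ht2 z hgt⟩
  refine ⟨s, t, ⟨?_, ?_, ?_, ?_, ?_⟩, ⟨?_, ?_, ?_, ?_, ?_⟩, ?_, ?_⟩
  · exact fun v hv => (h.left_abs_le hs hv.1).2.2.1
  · intro v hv hne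
    rw [sub_zero]
    exact (h.left_abs_le hs hv.1).2.2.2 hne
  · intro v hv
    rcases h.left_cases hs hv.1 with ⟨p, hp, hp1, hpS, hpe⟩ | ⟨p, hp, hpS, hpe, hpl, hpu⟩ | ⟨hn, hn0⟩
    · exact hpS
    · exact hpS
    · rw [hn0, add_zero]
      exact hv.1
  · intro v hv v' hv' hd
    rw [sub_zero] at hd
    exact h.left_loc hs hv.1 hv'.1 hd
  · exact fun v hv v' hv' => h.left_bilip hs hv.1 hv.2 hv'.1 hv'.2
  · intro v _
    rcases le_or_gt v (ℓ * R 0) with hle | hgt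
    · rw [ht1 v hle, abs_neg, abs_of_pos hDR]
    · rw [ht2 v hgt, abs_zero]
      exact hDR.le
  · intro v hv hne
    have hv0 : (0 : ℝ) ≤ v := hv.2
    rw [sub_zero, abs_of_nonneg hv0]
    rcases le_or_gt v (ℓ * R 0) with hle | hgt
    · linarith
    · exact absurd (ht2 v hgt) hne
  · intro v hv
    rcases himg v hv.1 hv.2 with h1 | h1
    · exact h1.2.1
    · rw [h1.2, add_zero]
      exact hv.1
  · intro v hv v' hv' hd
    have hv0 : (0 : ℝ) ≤ v := hv.2
    rw [sub_zero, abs_of_nonneg hv0] at hd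
    obtain ⟨hd1, hd2⟩ := abs_lt.1 hd
    have hsmall : γ * κ / (2 * D) * (ℓ * R 0) ≤ γ * R 0 := by
      have h1 := hηR 0
      have h2 := mul_le_mul_of_nonneg_left (h.R_le (Nat.le_succ 0)) hγ.le
      refine le_trans (mul_le_mul_of_nonneg_left ?_ hη.le) (h1.le.trans h2)
      linarith
    rcases le_or_gt v (ℓ * R 0) with hle | hgt
    · rcases le_or_gt v' (ℓ * R 0) with hle' | hgt'
      · rw [ht1 v hle, ht1 v' hle']
      · exfalso
        have h1 := hgap v' hv'.1 hgt'
        have h2 := mul_le_mul_of_nonneg_left hle hη.le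
        linarith
    · rcases le_or_gt v' (ℓ * R 0) with hle' | hgt'
      · exfalso
        have h1 := hgap v hv.1 hgt
        -- the quotient of `γ * R 0` and `(ℓ + γ) * R 0` is at least `2 * η`
        have h2 : γ * κ / (2 * D) * ((ℓ + γ) * R 0) ≤ γ * R 0 / 2 := by
          have h3 := hηR 0
          have h4 := mul_le_mul_of_nonneg_left (h.R_le (Nat.le_succ 0)) hγ.le
          have h5 : γ * κ / (2 * D) * (2 * ((ℓ + γ) * R 0)) ≤ γ * κ / (2 * D) * (2 * (D * R 0)) :=
            mul_le_mul_of_nonneg_left (by nlinarith) hη.le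
          rw [Nat.succ_eq_add_one] at h4
          linarith
        have h6 := mul_le_mul_of_nonneg_right hη4 (sub_nonneg.2 h1)
        linarith
      · rw [ht2 v hgt, ht2 v' hgt']
  · have key : ∀ v ∈ S ∩ Set.Ici (0 : ℝ), ∀ v' ∈ S ∩ Set.Ici (0 : ℝ), v ≤ v' →
        |v - v'| ≤ bilipConst ℓ γ κ D * |v + t v - (v' + t v')| ∧
        |v + t v - (v' + t v')| ≤ bilipConst ℓ γ κ D * |v - v'| := by
      intro v hv v' hv' hle
      by_cases heq : t v = t v'
      · have : v + t v - (v' + t v') = v - v' := by rw [heq]; ring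
        rw [this]
        have h1 : 1 ≤ bilipConst ℓ γ κ D := by linarith
        exact ⟨le_mul_of_one_le_left (abs_nonneg _) h1, le_mul_of_one_le_left (abs_nonneg _) h1⟩
      · have hvle : v ≤ ℓ * R 0 := by
          by_contra hn
          rw [not_le] at hn
          exact heq (by rw [ht2 v hn, ht2 v' (hn.trans_le hle)])
        have hvgt : ℓ * R 0 < v' := by
          by_contra hn
          rw [not_lt] at hn
          exact heq (by rw [ht1 v hvle, ht1 v' hn])
        have h1 := hgap v' hv'.1 hvgt
        rw [ht1 v hvle, ht2 v' hvgt, abs_sub_comm, abs_of_nonneg (sub_nonneg.2 hle), abs_sub_comm,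
          abs_of_nonneg (by linarith)]
        have h2 : γ * R 0 ≤ v' - v := by linarith
        have h3 : D * R 0 ≤ D / γ * (v' - v) := by
          rw [div_mul_eq_mul_div, le_div_iff₀ hγ]
          have := mul_le_mul_of_nonneg_left h2 hD.le
          linarith
        have h4 : 0 ≤ v' - v := sub_nonneg.2 hle
        have h5 := mul_le_mul_of_nonneg_right hone h4
        have h6 : 1 ≤ bilipConst ℓ γ κ D := by linarith
        constructor
        · have := le_mul_of_one_le_left (show 0 ≤ v' + 0 - (v + -(D * R 0)) by linarith) h6
          linarith
        · linarith
    intro v hv v' hv'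
    rcases le_total v v' with hle | hle
    · exact key v hv v' hv' hle
    · rw [abs_sub_comm v v', abs_sub_comm (v + t v)]
      exact key v' hv' v hv hle
  · intro v hv v' hv' heq
    rcases himg v' hv'.1 hv'.2 with ⟨h1, -, -⟩ | ⟨h1, h2⟩
    · rw [← heq] at h1
      rcases h.left_cases hs hv.1 with ⟨p, hp, hp1, hpS, hpe⟩ | ⟨p, hp, hpS, hpe, hpl, hpu⟩ |
        ⟨hn, hn0⟩
      · exact absurd (h.inCopy_unique h1 hp1) (Nat.succ_ne_zero p).symm
      · have h3 := (h.inCopy_bounds h1).1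
        have h4 : 0 < (ℓ + γ) * R (p + 1) := mul_pos (by linarith) (h.R_pos _)
        linarith
      · rw [hn0, add_zero] at h1
        exact hn 0 h1
    · rw [h2, add_zero] at heq
      have h3 := mul_pos hℓ hR
      rcases h.left_cases hs hv.1 with ⟨p, hp, hp1, hpS, hpe⟩ | ⟨p, hp, hpS, hpe, hpl, hpu⟩ |
        ⟨hn, hn0⟩
      · have := (h.inCopy_bounds hp1).1
        linarith
      · have := mul_le_mul_of_nonneg_left (h.R_le (Nat.zero_le p)) hℓ.le
        linarith
      · have : v ≤ 0 := hv.2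
        rw [hn0] at heq
        linarith
  · intro y hy
    rcases lt_trichotomy y 0 with hneg | hzero | hpos
    · by_cases hc : ∃ p, InCopy ℓ D R p y
      · obtain ⟨p, hp⟩ := hc
        have hu : y + D * R p ∈ S := by
          rw [h.copy p _ hp.1 hp.2]
          simpa using hy
        cases p with
        | zero =>
          right
          exact ⟨y + D * R 0, ⟨hu, hp.1⟩, by rw [ht1 _ hp.2]; ring⟩
        | succ p =>
          left
          have hle : y + D * R (p + 1) ≤ ℓ * R p :=
            hp.2.trans (mul_le_mul_of_nonneg_left (h.R_le (Nat.le_succ p)) hℓ.le)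
          have hcopy : InCopy ℓ D R p (y + D * R (p + 1) - D * R p) :=
            ⟨by simpa using hp.1, by simpa using hle⟩
          refine ⟨y + D * R (p + 1) - D * R p, ⟨(h.copy p _ hp.1 hle).1 hu,
            (h.inCopy_bounds hcopy).1.le⟩, ?_⟩
          rw [(hs _).1 p hcopy (by simpa using hp.2)]
          ring
      · left
        rw [not_exists] at hc
        exact ⟨y, ⟨hy, hneg.le⟩, by rw [(hs y).2.2 hc, add_zero]⟩
    · left
      subst hzero
      refine ⟨0, ⟨hy, le_refl (0 : ℝ)⟩, ?_⟩
      rw [(hs 0).2.2 fun p hp => lt_irrefl _ (h.inCopy_bounds hp).1, add_zero]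
    · rcases le_or_gt y (ℓ * R 0) with hle | hgt
      · left
        -- the scale `p` with `ℓ * R (p + 1) < y ≤ ℓ * R p`
        have hℓR := mul_pos hℓ hR
        obtain ⟨p, hp1, hp2⟩ := exists_nat_pow_near_of_lt_one (div_pos hpos hℓR)
          ((div_le_one hℓR).2 hle) hκ h.κ_lt_one
        rw [lt_div_iff₀ hℓR] at hp1
        rw [div_le_iff₀ hℓR] at hp2
        have h1 : y ≤ ℓ * R p := by rw [h.R_eq p]; linarith
        have h2 : ℓ * R (p + 1) < y := by rw [h.R_eq (p + 1)]; linarith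
        have hcopy : InCopy ℓ D R p (y - D * R p) := ⟨by simpa using hpos.le, by simpa using h1⟩
        refine ⟨y - D * R p, ⟨(h.copy p y hpos.le h1).1 hy, (h.inCopy_bounds hcopy).1.le⟩, ?_⟩
        rw [(hs _).2.1 p hcopy (by simpa using h2)]
        ring
      · right
        exact ⟨y, ⟨hy, hpos.le⟩, by rw [ht2 y hgt, add_zero]⟩

end TouchingModel

end TouchingIFS

/-! ### Geometry of the attractor near touching points -/

namespace TouchingIFS

/-- The attractor `T` of maps `x ↦ ρ i * x + t i` which send `[0, 1]` to intervals arranged from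
left to right in `[0, 1]`, with common end points allowed. -/
structure IsIntervalIFS {m : ℕ} (ρ t : Fin (m + 1) → ℝ) (T : Set ℝ) : Prop where
  pos : ∀ i, 0 < ρ i
  lt_one : ∀ i, ρ i < 1
  step : ∀ i : Fin m, ρ i.castSucc + t i.castSucc ≤ t i.succ
  left_end : t 0 = 0
  right_end : ρ (Fin.last m) + t (Fin.last m) = 1
  isAttractor : IsAttractor (affineMaps ρ t) T

lemma isTouching_affineMaps {m : ℕ} {ρ t : Fin (m + 1) → ℝ} {i : Fin m} :
    IsTouching (affineMaps ρ t) i ↔ ρ i.castSucc + t i.castSucc = t i.succ := by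
  simp [IsTouching, affineMaps]

lemma wordMap_affineMaps {ι : Type*} (ρ t : ι → ℝ) (w : List ι) (y : ℝ) :
    wordMap (affineMaps ρ t) w y = wordRatio ρ w * y + wordMap (affineMaps ρ t) w 0 := by
  induction w with
  | nil => simp
  | cons i w ih =>
    rw [wordMap_cons, wordMap_cons, ih, wordRatio_cons]
    unfold affineMaps
    ring

namespace IsIntervalIFS

variable {m : ℕ} {ρ t : Fin (m + 1) → ℝ} {T : Set ℝ}

lemma le_of_lt (h : IsIntervalIFS ρ t T) {i j : Fin (m + 1)} (hij : i < j) : ρ i + t i ≤ t j := by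
  have hmono : Monotone t := Fin.monotone_iff_le_succ.2 fun i => by
    linarith [h.step i, h.pos i.castSucc]
  have hi : i ≠ Fin.last m := ((Fin.le_last j).trans_lt' hij).ne
  obtain ⟨k, rfl⟩ := Fin.exists_castSucc_eq.2 hi
  exact (h.step k).trans (hmono (Fin.castSucc_lt_iff_succ_le.1 hij))

lemma t_nonneg (h : IsIntervalIFS ρ t T) (i : Fin (m + 1)) : 0 ≤ t i := by
  rcases (Fin.zero_le i).eq_or_lt with rfl | hi
  · exact h.left_end.ge
  · have := h.le_of_lt hi
    linarith [h.left_end, h.pos 0]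

lemma add_le_one (h : IsIntervalIFS ρ t T) (i : Fin (m + 1)) : ρ i + t i ≤ 1 := by
  rcases (Fin.le_last i).eq_or_lt with rfl | hi
  · exact h.right_end.le
  · have := h.le_of_lt hi
    linarith [h.right_end, h.pos (Fin.last m)]

lemma mem_Icc (h : IsIntervalIFS ρ t T) {x : ℝ} (hx : x ∈ T) : 0 ≤ x ∧ x ≤ 1 := by
  obtain ⟨a, ha, hmin⟩ := h.isAttractor.isCompact.exists_isLeast h.isAttractor.nonempty
  obtain ⟨b, hb, hmax⟩ := h.isAttractor.isCompact.exists_isGreatest h.isAttractor.nonempty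
  obtain ⟨i, y, hy, hya⟩ := h.isAttractor.exists_preimage ha
  obtain ⟨j, z, hz, hzb⟩ := h.isAttractor.exists_preimage hb
  have h1 := hmin hy
  have h2 := hmax hz
  have h3 := mul_le_mul_of_nonneg_left h1 (h.pos i).le
  have h4 := mul_le_mul_of_nonneg_left h2 (h.pos j).le
  unfold affineMaps at hya hzb
  have h5 := h.t_nonneg i
  have h6 := h.add_le_one j
  have h7 : 0 ≤ a := by nlinarith [h.lt_one i]
  have h8 : b ≤ 1 := by nlinarith [h.lt_one j]
  exact ⟨h7.trans (hmin hx), (hmax hx).trans h8⟩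

lemma zero_mem (h : IsIntervalIFS ρ t T) : (0 : ℝ) ∈ T := by
  obtain ⟨a, ha, hmin⟩ := h.isAttractor.isCompact.exists_isLeast h.isAttractor.nonempty
  have h1 := hmin (h.isAttractor.mapsTo 0 a ha)
  have h0 := (h.mem_Icc ha).1
  simp only [affineMaps, h.left_end] at h1
  have : a = 0 := by nlinarith [h.lt_one 0]
  rwa [← this]

lemma one_mem (h : IsIntervalIFS ρ t T) : (1 : ℝ) ∈ T := by
  obtain ⟨b, hb, hmax⟩ := h.isAttractor.isCompact.exists_isGreatest h.isAttractor.nonempty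
  have h1 := hmax (h.isAttractor.mapsTo (Fin.last m) b hb)
  have h0 := (h.mem_Icc hb).2
  have h2 := h.right_end
  simp only [affineMaps] at h1
  have : b = 1 := by nlinarith [h.lt_one (Fin.last m)]
  rwa [← this]

lemma affineMaps_mem_iff (h : IsIntervalIFS ρ t T) (j : Fin (m + 1)) {y : ℝ} (h0 : 0 ≤ y)
    (h1 : y ≤ 1) : affineMaps ρ t j y ∈ T ↔ y ∈ T := by
  refine ⟨fun hy => ?_, h.isAttractor.mapsTo j y⟩
  obtain ⟨k, y', hy', heq⟩ := h.isAttractor.exists_preimage hy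
  obtain ⟨h0', h1'⟩ := h.mem_Icc hy'
  unfold affineMaps at heq
  have hj := h.pos j
  have hk := h.pos k
  rcases lt_trichotomy k j with hlt | rfl | hgt
  · have h2 := h.le_of_lt hlt
    have : y = 0 := by nlinarith
    rw [this]
    exact h.zero_mem
  · have : y = y' := by
      have : ρ k * (y - y') = 0 := by linarith
      rcases mul_eq_zero.1 this with h3 | h3
      · exact absurd h3 hk.ne'
      · exact sub_eq_zero.1 h3
    rwa [this]
  · have h2 := h.le_of_lt hgt
    have : y = 1 := by nlinarith
    rw [this]
    exact h.one_mem

lemma affineMaps_mem_Icc (h : IsIntervalIFS ρ t T) (j : Fin (m + 1)) {y : ℝ} (h0 : 0 ≤ y)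
    (h1 : y ≤ 1) : 0 ≤ affineMaps ρ t j y ∧ affineMaps ρ t j y ≤ 1 := by
  unfold affineMaps
  have h2 := mul_nonneg (h.pos j).le h0
  have h3 := mul_le_mul_of_nonneg_left h1 (h.pos j).le
  constructor
  · linarith [h.t_nonneg j]
  · linarith [h.add_le_one j]

lemma wordMap_mem_iff (h : IsIntervalIFS ρ t T) (w : List (Fin (m + 1))) {y : ℝ} (h0 : 0 ≤ y)
    (h1 : y ≤ 1) : (wordMap (affineMaps ρ t) w y ∈ T ↔ y ∈ T) ∧
      0 ≤ wordMap (affineMaps ρ t) w y ∧ wordMap (affineMaps ρ t) w y ≤ 1 := by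
  induction w with
  | nil => exact ⟨Iff.rfl, h0, h1⟩
  | cons i w ih =>
    obtain ⟨ih1, ih2, ih3⟩ := ih
    rw [wordMap_cons]
    exact ⟨(h.affineMaps_mem_iff i ih2 ih3).trans ih1, h.affineMaps_mem_Icc i ih2 ih3⟩

lemma gap (h : IsIntervalIFS ρ t T) (l : Fin m) {y : ℝ} (hy : y ∈ T) :
    y ≤ ρ l.castSucc + t l.castSucc ∨ t l.succ ≤ y := by
  obtain ⟨k, x, hx, rfl⟩ := h.isAttractor.exists_preimage hy
  obtain ⟨h0, h1⟩ := h.mem_Icc hx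
  unfold affineMaps
  have hk := h.pos k
  rcases le_or_gt k l.castSucc with hle | hgt
  · left
    rcases hle.eq_or_lt with rfl | hlt
    · have := mul_le_mul_of_nonneg_left h1 hk.le
      linarith
    · have h2 := h.le_of_lt hlt
      have := mul_le_mul_of_nonneg_left h1 hk.le
      linarith [h.pos l.castSucc]
  · right
    have hxk := mul_nonneg hk.le h0
    rcases (Fin.castSucc_lt_iff_succ_le.1 hgt).eq_or_lt with rfl | hlt
    · linarith
    · linarith [h.le_of_lt hlt, h.pos l.succ]

lemma wordMap_replicate_zero (h : IsIntervalIFS ρ t T) (k : ℕ) :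
    wordMap (affineMaps ρ t) (List.replicate k 0) 0 = 0 := by
  induction k with
  | zero => rfl
  | succ k ih => rw [List.replicate_succ, wordMap_cons, ih]; simp [affineMaps, h.left_end]

lemma wordMap_replicate_last (h : IsIntervalIFS ρ t T) (k : ℕ) (y : ℝ) :
    wordMap (affineMaps ρ t) (List.replicate k (Fin.last m)) y =
      1 - ρ (Fin.last m) ^ k * (1 - y) := by
  induction k with
  | zero => simp
  | succ k ih =>
    rw [List.replicate_succ, wordMap_cons, ih, pow_succ]
    unfold affineMaps
    linear_combination h.right_end

/-- The picture near a touching point that is left substitutable. The copies of the initial piece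
of the right part are found at the words `i n^(b p) u l' 1^(k' + s)`, where `l'` is the successor of the letter `l` that
does not touch it; if `s` is large they are small in comparison with their distances from the
touching point. -/
lemma exists_touchingModel (h : IsIntervalIFS ρ t T) {i l : Fin m}
    (hi : ρ i.castSucc + t i.castSucc = t i.succ) (hl : ρ l.castSucc + t l.castSucc ≠ t l.succ)
    {a b : ℕ} (ha : a ≠ 0) (hab : ρ 0 ^ a = ρ (Fin.last m) ^ b)
    {u : List (Fin (m + 1))} {k k' : ℕ}
    (hu : ρ i.succ * ρ 0 ^ k = ρ i.castSucc * wordRatio ρ (u ++ [l.succ]) * ρ 0 ^ k') :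
    ∃ ℓ γ κ D R, TouchingModel {z | t i.succ + z ∈ T} ℓ γ κ D R := by
  set ψ := affineMaps ρ t with hψ
  set κ := ρ 0 ^ a with hκ
  have hκ0 : 0 < κ := pow_pos (h.pos 0) _
  have hκ1 : κ < 1 := pow_lt_one₀ (h.pos 0).le (h.lt_one 0) ha
  set ℓ := ρ l.castSucc + t l.castSucc with hℓ
  have hℓ0 : 0 < ℓ := by linarith [h.pos l.castSucc, h.t_nonneg l.castSucc]
  have hγ0 : 0 < t l.succ - ℓ := sub_pos.2 (lt_of_le_of_ne (h.step l) hl)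
  have hγ1 : t l.succ < 1 := by linarith [h.add_le_one l.succ, h.pos l.succ]
  have hr := wordRatio_pos h.pos (u ++ [l.succ])
  set d := ρ i.castSucc * (1 - wordMap ψ (u ++ [l.succ]) 0) with hd
  have hd0 : 0 < d := by
    have h1 := (h.wordMap_mem_iff (u ++ [l.succ]) zero_le_one le_rfl).2.2
    rw [wordMap_affineMaps] at h1
    exact mul_pos (h.pos _) (by linarith)
  obtain ⟨s, hs⟩ := exists_pow_lt_of_lt_one
    (show 0 < d * (1 - κ) / 3 from div_pos (mul_pos hd0 (by linarith)) (by norm_num)) (h.lt_one 0)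
  set r := ρ i.succ * ρ 0 ^ (k + s) with hr_def
  have hr0 : 0 < r := mul_pos (h.pos _) (pow_pos (h.pos 0) _)
  have hrs : r ≤ ρ 0 ^ s := by
    rw [hr_def, pow_add, ← mul_assoc]
    refine mul_le_of_le_one_left (pow_pos (h.pos 0) _).le ?_
    exact mul_le_one₀ (h.lt_one _).le (pow_pos (h.pos 0) _).le
      (pow_le_one₀ (h.pos 0).le (h.lt_one 0).le)
  have hR : ∀ p, 0 < r * κ ^ p := fun p => mul_pos hr0 (pow_pos hκ0 p)
  have hDR : ∀ p, d / r * (r * κ ^ p) = d * κ ^ p := fun p => by field_simp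
  -- the words of the initial pieces and of their copies
  set v : ℕ → List (Fin (m + 1)) := fun p => i.succ :: List.replicate (k + s + a * p) 0 with hv
  set w' : ℕ → List (Fin (m + 1)) := fun p =>
    i.castSucc :: (List.replicate (b * p) (Fin.last m) ++ u) with hw'
  set w : ℕ → List (Fin (m + 1)) := fun p => w' p ++ l.succ :: List.replicate (k' + s) 0 with hw
  have hvr : ∀ p, wordRatio ρ (v p) = r * κ ^ p := fun p => by
    rw [hv, wordRatio_cons, wordRatio_replicate, hr_def, hκ, pow_add, pow_mul, mul_assoc]
  have hwr' : ∀ p, wordRatio ρ (w' p) = ρ i.castSucc * (κ ^ p * wordRatio ρ u) := fun p => by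
    rw [hw', wordRatio_cons, wordRatio_append, wordRatio_replicate, hab, pow_mul]
  have hwr : ∀ p, wordRatio ρ (w p) = r * κ ^ p := fun p => by
    rw [hw, wordRatio_append, hwr', wordRatio_cons, wordRatio_replicate, hr_def, pow_add, pow_add]
    rw [wordRatio_append, wordRatio_cons, wordRatio_nil] at hu
    linear_combination (-(ρ 0 ^ s * κ ^ p)) * hu
  have hv0 : ∀ p, wordMap ψ (v p) 0 = t i.succ := fun p => by
    rw [hv, wordMap_cons, h.wordMap_replicate_zero]
    simp [hψ, affineMaps]
  have hw0' : ∀ p, wordMap ψ (w' p) (t l.succ) = t i.succ - d * κ ^ p := fun p => by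
    have h1 : wordMap ψ (u ++ [l.succ]) 0 = wordMap ψ u (t l.succ) := by
      rw [wordMap_append]
      simp [hψ, affineMaps]
    rw [hw', wordMap_cons, wordMap_append, h.wordMap_replicate_last, hd, h1, hψ, affineMaps,
      pow_mul, ← hab]
    linear_combination hi
  have hw0 : ∀ p, wordMap ψ (w p) 0 = t i.succ - d * κ ^ p := fun p => by
    have h1 : wordMap ψ (l.succ :: List.replicate (k' + s) 0) 0 = t l.succ := by
      rw [wordMap_cons, h.wordMap_replicate_zero]
      simp [hψ, affineMaps]
    rw [hw, wordMap_append, h1, hw0' p]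
  have hvz : ∀ p z, wordMap ψ (v p) (z / (r * κ ^ p)) = t i.succ + z := fun p z => by
    rw [wordMap_affineMaps, hvr, ← hψ, hv0, mul_div_cancel₀ _ (hR p).ne']
    ring
  have hwz : ∀ p z, wordMap ψ (w p) (z / (r * κ ^ p)) = t i.succ + (z - d * κ ^ p) := fun p z => by
    rw [wordMap_affineMaps, hwr, ← hψ, hw0, mul_div_cancel₀ _ (hR p).ne']
    ring
  have hpiece : ∀ p z, z / (r * κ ^ p) ∈ T → z < t l.succ * (r * κ ^ p) → z ≤ ℓ * (r * κ ^ p) := by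
    intro p z hz hlt
    rcases h.gap l hz with h1 | h1
    · exact (div_le_iff₀ (hR p)).1 h1
    · exact absurd ((le_div_iff₀ (hR p)).1 h1) (not_le.2 hlt)
  have hunit : ∀ p z, 0 ≤ z → z < t l.succ * (r * κ ^ p) →
      0 ≤ z / (r * κ ^ p) ∧ z / (r * κ ^ p) ≤ 1 := by
    intro p z h0 hlt
    refine ⟨div_nonneg h0 (hR p).le, (div_le_one (hR p)).2 (hlt.le.trans ?_)⟩
    exact mul_le_of_le_one_left (hR p).le hγ1.le
  refine ⟨ℓ, t l.succ - ℓ, κ, d / r, fun p => r * κ ^ p, hℓ0, hγ0, hκ0, hκ1, ?_, hR, ?_, ?_, ?_,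
    ?_⟩
  · have h1 : 3 ≤ (1 - κ) * (d / r) := by
      rw [← mul_div_assoc, le_div_iff₀ hr0]
      linarith
    have h2 : κ * (t l.succ - ℓ) ≤ 1 := mul_le_one₀ hκ1.le hγ0.le (by linarith)
    linarith
  · intro p
    rw [pow_succ]
    ring
  · intro p z hz h0 hlt
    rw [add_sub_cancel] at hlt
    obtain ⟨h1, h2⟩ := hunit p z h0 hlt
    rw [Set.mem_ofPred_eq, ← hvz p, (h.wordMap_mem_iff (v p) h1 h2).1] at hz
    exact hpiece p z hz hlt
  · intro p z hz hneg hlt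
    rw [add_sub_cancel] at hlt
    rw [Set.mem_ofPred_eq, hDR] at hz
    by_cases h0 : 0 ≤ z
    · obtain ⟨h1, h2⟩ := hunit p z h0 hlt
      rw [← hwz p, (h.wordMap_mem_iff (w p) h1 h2).1] at hz
      exact ⟨h0, hpiece p z hz hlt⟩
    · -- to the left of the copy there is the image of the gap in front of the last letter of `u`
      exfalso
      rw [not_le] at h0
      have hq := wordRatio_pos h.pos (w' p)
      set q := wordRatio ρ (w' p) with hqdef
      have hqR : r * κ ^ p ≤ q := by
        rw [← hwr, hw, wordRatio_append]
        exact mul_le_of_le_one_right hq.le (wordRatio_le_one h.pos h.lt_one _)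
      have hz' : -(t l.succ - ℓ) < z / q := by
        rw [lt_div_iff₀ hq]
        have := mul_le_mul_of_nonneg_left hqR hγ0.le
        linarith
      have hzneg : z / q < 0 := div_neg_of_neg_of_pos h0 hq
      have heq : wordMap ψ (w' p) (t l.succ + z / q) = t i.succ + (z - d * κ ^ p) := by
        have h1 := hw0' p
        rw [wordMap_affineMaps, ← hqdef] at h1 ⊢
        rw [mul_add, mul_div_cancel₀ _ hq.ne']
        linarith
      rw [← heq, (h.wordMap_mem_iff (w' p) (by linarith) (by linarith)).1] at hz
      rcases h.gap l hz with h1 | h1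
      · linarith
      · linarith
  · intro p z h0 hle
    have hlt : z < t l.succ * (r * κ ^ p) :=
      hle.trans_lt (mul_lt_mul_of_pos_right (by linarith) (hR p))
    obtain ⟨h1, h2⟩ := hunit p z h0 hlt
    rw [Set.mem_ofPred_eq, Set.mem_ofPred_eq, hDR, ← hvz p, ← hwz p,
      (h.wordMap_mem_iff (v p) h1 h2).1, (h.wordMap_mem_iff (w p) h1 h2).1]

/-- The reflection `x ↦ 1 - x` reverses the order of the letters. -/
lemma reflect (h : IsIntervalIFS ρ t T) :
    IsIntervalIFS (fun j => ρ j.rev) (fun j => 1 - ρ j.rev - t j.rev) {y | 1 - y ∈ T} where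
  pos j := h.pos _
  lt_one j := h.lt_one _
  step i := by
    have := h.step i.rev
    rw [← Fin.rev_castSucc, ← Fin.rev_succ] at this
    linarith
  left_end := by
    rw [Fin.rev_zero]
    linarith [h.right_end]
  right_end := by
    rw [Fin.rev_last]
    linarith [h.left_end]
  isAttractor := by
    refine ⟨⟨0, ?_⟩, ?_, ?_⟩
    · simpa using h.one_mem
    · have : {y : ℝ | 1 - y ∈ T} = (fun y => 1 - y) '' T := by
        ext y
        constructor
        · exact fun hy => ⟨1 - y, hy, by ring⟩
        · rintro ⟨x, hx, rfl⟩
          simpa using hx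
      rw [this]
      exact h.isAttractor.isCompact.image (by fun_prop)
    · ext y
      simp only [Set.mem_iUnion, Set.mem_image, Set.mem_ofPred_eq]
      constructor
      · rintro ⟨j, x, hx, rfl⟩
        have := h.isAttractor.mapsTo j.rev _ hx
        unfold affineMaps at this ⊢
        convert this using 1
        ring
      · intro hy
        obtain ⟨j, x, hx, hxy⟩ := h.isAttractor.exists_preimage hy
        refine ⟨j.rev, 1 - x, by simpa using hx, ?_⟩
        simp only [affineMaps, Fin.rev_rev] at hxy ⊢
        linarith

/-- The mirror image of `exists_touchingModel`. -/
lemma exists_touchingModel_reflect (h : IsIntervalIFS ρ t T) {i l : Fin m}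
    (hi : ρ i.castSucc + t i.castSucc = t i.succ) (hl : ρ l.castSucc + t l.castSucc ≠ t l.succ)
    {a b : ℕ} (hb : b ≠ 0) (hab : ρ 0 ^ a = ρ (Fin.last m) ^ b)
    {u : List (Fin (m + 1))} {k k' : ℕ}
    (hu : ρ i.castSucc * ρ (Fin.last m) ^ k =
      ρ i.succ * wordRatio ρ (u ++ [l.castSucc]) * ρ (Fin.last m) ^ k') :
    ∃ ℓ γ κ D R, TouchingModel {z | t i.succ - z ∈ T} ℓ γ κ D R := by
  have hword : ∀ w : List (Fin (m + 1)),
      wordRatio (fun j => ρ j.rev) (w.map Fin.rev) = wordRatio ρ w := fun w => by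
    unfold wordRatio
    rw [List.map_map]
    congr 2
    funext j
    simp
  have hlast := hword (u ++ [l.castSucc])
  rw [List.map_append, List.map_singleton, Fin.rev_castSucc] at hlast
  obtain ⟨ℓ, γ, κ, D, R, hm⟩ := h.reflect.exists_touchingModel (i := i.rev) (l := l.rev)
    (a := b) (b := a) (u := u.map Fin.rev) (k := k) (k' := k')
    (by simp only [Fin.rev_succ, Fin.rev_castSucc, Fin.rev_rev]; linarith)
    (by
      simp only [Fin.rev_succ, Fin.rev_castSucc, Fin.rev_rev]
      exact fun heq => hl (by linarith))
    hb (by simpa only [Fin.rev_zero, Fin.rev_last] using hab.symm)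
    (by
      rw [hlast]
      simpa only [Fin.rev_succ, Fin.rev_castSucc, Fin.rev_rev, Fin.rev_zero] using hu)
  refine ⟨ℓ, γ, κ, D, R, ?_⟩
  convert hm using 1
  ext z
  simp only [Set.mem_ofPred_eq, Fin.rev_succ, Fin.rev_rev]
  rw [← hi]
  ring_nf

end IsIntervalIFS

end TouchingIFS

/-! ### Transport of displacements and separation at substitutable letters -/

namespace TouchingIFS

/-- Displacements are transported by isometries of the line. -/
lemma IsDisplacement.of_comp {S A : Set ℝ} {a e η C ε : ℝ} {s : ℝ → ℝ} (he : e * e = 1)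
    (h : IsDisplacement {z | a + e * z ∈ S} {z | a + e * z ∈ A} 0 η C ε s) :
    IsDisplacement S A a η C ε fun v => e * s (e * (v - a)) := by
  have habs : |e| = 1 := by
    rcases mul_self_eq_one_iff.1 he with rfl | rfl <;> simp
  have hback : ∀ v, a + e * (e * (v - a)) = v := fun v => by linear_combination (v - a) * he
  have hmem : ∀ v ∈ A, e * (v - a) ∈ {z | a + e * z ∈ A} := fun v hv => by
    rw [Set.mem_ofPred_eq, hback]
    exact hv
  have hdist : ∀ v v', |e * (v - a) - e * (v' - a)| = |v - v'| := fun v v' => by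
    rw [← mul_sub, abs_mul, habs, one_mul]
    ring_nf
  have hnorm : ∀ v, |e * (v - a) - 0| = |v - a| := fun v => by
    rw [sub_zero, abs_mul, habs, one_mul]
  have himg : ∀ v v', |e * (v - a) + s (e * (v - a)) - (e * (v' - a) + s (e * (v' - a)))| =
      |v + e * s (e * (v - a)) - (v' + e * s (e * (v' - a)))| := fun v v' => by
    rw [← one_mul |v + e * s (e * (v - a)) - (v' + e * s (e * (v' - a)))|, ← habs, ← abs_mul]
    congr 1
    linear_combination (s (e * (v' - a)) - s (e * (v - a))) * he
  refine ⟨fun v hv => ?_, fun v hv hne => ?_, fun v hv => ?_, fun v hv v' hv' hd => ?_,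
    fun v hv v' hv' => ?_⟩
  · rw [abs_mul, habs, one_mul]
    exact h.small _ (hmem v hv)
  · rw [← hnorm]
    exact h.supp _ (hmem v hv) (right_ne_zero_of_mul hne)
  · have := h.mem _ (hmem v hv)
    rw [Set.mem_ofPred_eq] at this
    convert this using 1
    linear_combination (a - v) * he
  · rw [h.loc _ (hmem v hv) _ (hmem v' hv') (by rwa [hdist, hnorm])]
  · have := h.bilip _ (hmem v hv) _ (hmem v' hv')
    rwa [hdist, himg] at this

lemma IsDisplacement.mono {S A : Set ℝ} {a η C ε η' C' ε' : ℝ} {s : ℝ → ℝ}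
    (h : IsDisplacement S A a η C ε s) (hη : η' ≤ η) (hC : C ≤ C') (hε : ε ≤ ε') :
    IsDisplacement S A a η' C' ε' s where
  small v hv := (h.small v hv).trans hε
  supp v hv hne := (h.supp v hv hne).trans hε
  mem := h.mem
  loc v hv v' hv' hd :=
    h.loc v hv v' hv' (hd.trans_le (mul_le_mul_of_nonneg_right hη (abs_nonneg _)))
  bilip v hv v' hv' := by
    obtain ⟨h1, h2⟩ := h.bilip v hv v' hv'
    exact ⟨h1.trans (mul_le_mul_of_nonneg_right hC (abs_nonneg _)),
      h2.trans (mul_le_mul_of_nonneg_right hC (abs_nonneg _))⟩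

lemma IsDisplacement.zero {S A : Set ℝ} {a η C ε : ℝ} (hA : A ⊆ S) (hC : 1 ≤ C) (hε : 0 ≤ ε) :
    IsDisplacement S A a η C ε 0 where
  small v _ := by simpa using hε
  supp v _ hne := absurd rfl hne
  mem v hv := by simpa using hA hv
  loc _ _ _ _ _ := rfl
  bilip v _ v' _ := by
    simp only [Pi.zero_apply, add_zero]
    exact ⟨le_mul_of_one_le_left (abs_nonneg _) hC, le_mul_of_one_le_left (abs_nonneg _) hC⟩

lemma IsSeparation.mono {S : Set ℝ} {a η C ε η' C' ε' : ℝ} {sl sr : ℝ → ℝ}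
    (h : IsSeparation S a η C ε sl sr) (hη : η' ≤ η) (hC : C ≤ C') (hε : ε ≤ ε') :
    IsSeparation S a η' C' ε' sl sr where
  left := h.left.mono hη hC hε
  right := h.right.mono hη hC hε
  disjoint := h.disjoint
  cover := h.cover

lemma IsSeparation.of_translate {S : Set ℝ} {a η C ε : ℝ} {sl sr : ℝ → ℝ}
    (h : IsSeparation {z | a + z ∈ S} 0 η C ε sl sr) :
    IsSeparation S a η C ε (fun v => sl (v - a)) fun v => sr (v - a) where
  left := by
    have := IsDisplacement.of_comp (S := S) (A := S ∩ Set.Iic a) (a := a) (s := sl) (mul_one (1 : ℝ))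
      (η := η) (C := C) (ε := ε) (by convert h.left using 1 <;> ext z <;> simp)
    simpa using this
  right := by
    have := IsDisplacement.of_comp (S := S) (A := S ∩ Set.Ici a) (a := a) (s := sr) (mul_one (1 : ℝ))
      (η := η) (C := C) (ε := ε) (by convert h.right using 1 <;> ext z <;> simp)
    simpa using this
  disjoint v hv v' hv' heq := h.disjoint (v - a) (by simpa using hv) (v' - a) (by simpa using hv')
    (by linarith)
  cover y hy := by
    rcases h.cover (y - a) (by simpa using hy) with ⟨v, hv, heq⟩ | ⟨v, hv, heq⟩
    · exact Or.inl ⟨a + v, by simpa using hv, by rw [add_sub_cancel_left]; linarith⟩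
    · exact Or.inr ⟨a + v, by simpa using hv, by rw [add_sub_cancel_left]; linarith⟩

lemma IsSeparation.of_reflect {S : Set ℝ} {a η C ε : ℝ} {sl sr : ℝ → ℝ}
    (h : IsSeparation {z | a - z ∈ S} 0 η C ε sl sr) :
    IsSeparation S a η C ε (fun v => -sr (a - v)) fun v => -sl (a - v) where
  left := by
    have := IsDisplacement.of_comp (S := S) (A := S ∩ Set.Iic a) (a := a) (s := sr) (e := -1)
      (by norm_num) (η := η) (C := C) (ε := ε)
      (by convert h.right using 1 <;> ext z <;> simp [sub_eq_add_neg])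
    simpa using this
  right := by
    have := IsDisplacement.of_comp (S := S) (A := S ∩ Set.Ici a) (a := a) (s := sl) (e := -1)
      (by norm_num) (η := η) (C := C) (ε := ε)
      (by convert h.left using 1 <;> ext z <;> simp [sub_eq_add_neg])
    simpa using this
  disjoint v hv v' hv' heq := h.disjoint (a - v') (by simpa using hv') (a - v) (by simpa using hv)
    (by linarith)
  cover y hy := by
    rcases h.cover (a - y) (by simpa using hy) with ⟨v, hv, heq⟩ | ⟨v, hv, heq⟩
    · exact Or.inr ⟨a - v, by simpa using hv, by rw [sub_sub_cancel]; linarith⟩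
    · exact Or.inl ⟨a - v, by simpa using hv, by rw [sub_sub_cancel]; linarith⟩

/-- At every scale the same constants work. -/
lemma TouchingModel.exists_isSeparation_small {S : Set ℝ} {ℓ γ κ D : ℝ} {R : ℕ → ℝ}
    (h : TouchingModel S ℓ γ κ D R) : ∃ η C : ℝ, 0 < η ∧ ∀ ε > 0, ∃ sl sr,
      IsSeparation S 0 η C ε sl sr := by
  refine ⟨_, bilipConst ℓ γ κ D, h.η_bounds.1, fun ε hε => ?_⟩
  have hDR := mul_pos h.D_pos (h.R_pos 0)
  obtain ⟨N, hN⟩ := exists_pow_lt_of_lt_one (div_pos hε hDR) h.κ_lt_one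
  obtain ⟨sl, sr, hs⟩ := (h.shift N).exists_isSeparation
  refine ⟨sl, sr, hs.mono le_rfl le_rfl ?_⟩
  rw [zero_add, h.R_eq]
  rw [lt_div_iff₀ hDR] at hN
  linarith

lemma exists_pow_eq_pow_of_log_div_rat {x y : ℝ} (hx : 0 < x) (hx1 : x < 1) (hy : 0 < y)
    (hy1 : y < 1) (h : ∃ r : ℚ, Real.log x / Real.log y = r) :
    ∃ a b : ℕ, a ≠ 0 ∧ b ≠ 0 ∧ x ^ a = y ^ b := by
  obtain ⟨r, hr⟩ := h
  have hlx := Real.log_neg hx hx1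
  have hly := Real.log_neg hy hy1
  have hr0 : 0 < r := by
    have : (0 : ℝ) < r := by
      rw [← hr]
      exact div_pos_of_neg_of_neg hlx hly
    exact_mod_cast this
  have hnum : ((r.num.toNat : ℤ) : ℚ) = r.num := by
    rw [Int.toNat_of_nonneg (Rat.num_pos.2 hr0).le]
  refine ⟨r.den, r.num.toNat, r.den_nz, ?_, ?_⟩
  · have := Rat.num_pos.2 hr0
    omega
  · refine Real.log_injOn_pos (pow_pos hx _) (pow_pos hy _) ?_
    rw [Real.log_pow, Real.log_pow]
    have h1 : (r : ℝ) * r.den = r.num.toNat := by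
      have h2 : r * r.den = ((r.num.toNat : ℤ) : ℚ) := by rw [hnum, Rat.mul_den_eq_num]
      exact_mod_cast h2
    rw [div_eq_iff hly.ne] at hr
    rw [hr, ← h1]
    ring

namespace IsIntervalIFS

variable {m : ℕ} {ρ t : Fin (m + 1) → ℝ} {T : Set ℝ}

lemma diam_image_wordMap (h : IsIntervalIFS ρ t T) (w : List (Fin (m + 1))) {s : Set ℝ}
    (hs : s ⊆ T) :
    Metric.diam (wordMap (affineMaps ρ t) w '' s) = wordRatio ρ w * Metric.diam s := by
  have hw := wordRatio_pos h.pos w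
  have hT := h.isAttractor.isCompact.isBounded
  have hdist : ∀ x y, dist (wordMap (affineMaps ρ t) w x) (wordMap (affineMaps ρ t) w y) =
      wordRatio ρ w * dist x y := fun x y => by
    rw [wordMap_affineMaps _ _ _ x, wordMap_affineMaps _ _ _ y, dist_add_right, Real.dist_eq,
      Real.dist_eq, ← mul_sub, abs_mul, abs_of_pos hw]
  have hbdd : Bornology.IsBounded (wordMap (affineMaps ρ t) w '' s) := by
    refine hT.subset ?_
    rintro _ ⟨x, hx, rfl⟩
    exact wordMap_mem h.isAttractor.mapsTo w (hs hx)
  refine le_antisymm ?_ ?_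
  · refine Metric.diam_le_of_forall_dist_le (mul_nonneg hw.le Metric.diam_nonneg) ?_
    rintro _ ⟨x, hx, rfl⟩ _ ⟨y, hy, rfl⟩
    rw [hdist]
    exact mul_le_mul_of_nonneg_left (Metric.dist_le_diam_of_mem (hT.subset hs) hx hy) hw.le
  · rw [mul_comm, ← le_div_iff₀ hw]
    refine Metric.diam_le_of_forall_dist_le (div_nonneg Metric.diam_nonneg hw.le) ?_
    intro x hx y hy
    rw [le_div_iff₀ hw, mul_comm, ← hdist]
    exact Metric.dist_le_diam_of_mem hbdd ⟨x, hx, rfl⟩ ⟨y, hy, rfl⟩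

/-- The diameters of patches with the same block of final letters are proportional to the ratios of
the words. -/
lemma wordRatio_eq_of_diam_patch_eq (h : IsIntervalIFS ρ t T) {B : Set (Fin (m + 1))}
    {e : Fin (m + 1)} (he : e ∈ B) {v w : List (Fin (m + 1))}
    (hd : Metric.diam (⋃ j ∈ B, cylinder (affineMaps ρ t) T (v ++ [j])) =
      Metric.diam (⋃ j ∈ B, cylinder (affineMaps ρ t) T (w ++ [j]))) :
    wordRatio ρ v = wordRatio ρ w := by
  set s := ⋃ j ∈ B, affineMaps ρ t j '' T with hs
  have hsT : s ⊆ T := by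
    refine Set.iUnion₂_subset fun j _ => ?_
    rintro _ ⟨x, hx, rfl⟩
    exact h.isAttractor.mapsTo j x hx
  have hpatch : ∀ w : List (Fin (m + 1)),
      (⋃ j ∈ B, cylinder (affineMaps ρ t) T (w ++ [j])) = wordMap (affineMaps ρ t) w '' s := by
    intro w
    rw [hs, Set.image_iUnion₂]
    refine Set.iUnion₂_congr fun j _ => ?_
    rw [cylinder, Set.image_image]
    exact Set.image_congr fun x _ => wordMap_append _ _ _
  rw [hpatch, hpatch, h.diam_image_wordMap v hsT, h.diam_image_wordMap w hsT] at hd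
  refine mul_right_cancel₀ (ne_of_gt ?_) hd
  have hmem : ∀ x ∈ T, affineMaps ρ t e x ∈ s := fun x hx =>
    Set.mem_iUnion₂.2 ⟨e, he, x, hx, rfl⟩
  refine lt_of_lt_of_le ?_ (Metric.dist_le_diam_of_mem (h.isAttractor.isCompact.isBounded.subset hsT)
    (hmem 1 h.one_mem) (hmem 0 h.zero_mem))
  simpa [Real.dist_eq, affineMaps] using (h.pos e).ne'

/-- Substitutable touching letters admit separations of the two touching parts, with constants that
do not depend on the size of the neighborhood in which points are moved. -/
lemma exists_isSeparation (h : IsIntervalIFS ρ t T)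
    (hlog : ∃ r : ℚ, Real.log (ρ 0) / Real.log (ρ (Fin.last m)) = (r : ℝ)) {i : Fin m}
    (hi : IsTouching (affineMaps ρ t) i) (hsub : Substitutable (affineMaps ρ t) T i) :
    ∃ η C : ℝ, 0 < η ∧ ∀ ε > 0, ∃ sl sr, IsSeparation T (t i.succ) η C ε sl sr := by
  obtain ⟨a, b, ha, hb, hab⟩ := exists_pow_eq_pow_of_log_div_rat (h.pos 0) (h.lt_one 0)
    (h.pos (Fin.last m)) (h.lt_one _) hlog
  rw [isTouching_affineMaps] at hi
  rcases hsub with ⟨u, hu, k, k', hd, h0, hn⟩ | ⟨u, hu, k, k', hd, h0, hn⟩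
  · have heq := h.wordRatio_eq_of_diam_patch_eq (e := 0)
      (fun l hl => absurd hl (not_le.2 (Fin.succ_pos l))) hd
    obtain ⟨l, hl⟩ := Fin.exists_succ_eq.2 h0
    rw [← List.dropLast_append_getLast hu, ← hl] at heq
    rw [wordRatio_append, wordRatio_append, wordRatio_replicate, wordRatio_replicate,
      wordRatio_cons, wordRatio_cons, wordRatio_nil, mul_one] at heq
    obtain ⟨ℓ, γ, κ, D, R, hm⟩ := h.exists_touchingModel hi
      (fun hl' => hn l (isTouching_affineMaps.2 hl') hl.symm) ha hab heq
    obtain ⟨η, C, hη, hs⟩ := hm.exists_isSeparation_small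
    refine ⟨η, C, hη, fun ε hε => ?_⟩
    obtain ⟨sl, sr, hsep⟩ := hs ε hε
    exact ⟨_, _, hsep.of_translate⟩
  · have heq := h.wordRatio_eq_of_diam_patch_eq (e := Fin.last m)
      (fun l hl => absurd hl (not_le.2 (Fin.castSucc_lt_last l))) hd
    obtain ⟨l, hl⟩ := Fin.exists_castSucc_eq.2 h0
    rw [← List.dropLast_append_getLast hu, ← hl] at heq
    rw [wordRatio_append, wordRatio_append, wordRatio_replicate, wordRatio_replicate,
      wordRatio_cons, wordRatio_cons, wordRatio_nil, mul_one] at heq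
    obtain ⟨ℓ, γ, κ, D, R, hm⟩ := h.exists_touchingModel_reflect hi
      (fun hl' => hn l (isTouching_affineMaps.2 hl') hl.symm) hb hab heq
    obtain ⟨η, C, hη, hs⟩ := hm.exists_isSeparation_small
    refine ⟨η, C, hη, fun ε hε => ?_⟩
    obtain ⟨sl, sr, hsep⟩ := hs ε hε
    exact ⟨_, _, hsep.of_reflect⟩

end IsIntervalIFS

end TouchingIFS

/-! ### The displaced maps -/

namespace TouchingIFS

/-- Displacements `L j` and `R j` near the left and the right end of the interval of each letter
`j`. They separate touching intervals and vanish at the other ends, and they are small in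
comparison with the intervals. -/
structure IsEndDisplacement {m : ℕ} (ρ t : Fin (m + 1) → ℝ) (T : Set ℝ) (η C ε : ℝ)
    (L R : Fin (m + 1) → ℝ → ℝ) : Prop where
  one_le : 1 ≤ C
  nonneg : 0 ≤ ε
  small : ∀ j, 32 * ε ≤ ρ j
  first : L 0 = 0
  last : R (Fin.last m) = 0
  separation : ∀ i : Fin m, IsTouching (affineMaps ρ t) i →
    IsSeparation T (t i.succ) η C ε (R i.castSucc) (L i.succ)
  zero : ∀ i : Fin m, ¬ IsTouching (affineMaps ρ t) i → R i.castSucc = 0 ∧ L i.succ = 0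

/-- The affine maps followed by the displacements near the ends of their intervals. -/
def displacedMaps {ι : Type*} (ρ t : ι → ℝ) (L R : ι → ℝ → ℝ) (j : ι) (x : ℝ) : ℝ :=
  affineMaps ρ t j x + L j (affineMaps ρ t j x) + R j (affineMaps ρ t j x)

namespace IsEndDisplacement

variable {m : ℕ} {ρ t : Fin (m + 1) → ℝ} {T : Set ℝ} {η C ε : ℝ} {L R : Fin (m + 1) → ℝ → ℝ}

lemma left (h : IsEndDisplacement ρ t T η C ε L R) (j : Fin (m + 1)) :
    IsDisplacement T (T ∩ Set.Ici (t j)) (t j) η C ε (L j) := by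
  refine Fin.cases ?_ (fun i => ?_) j
  · rw [h.first]
    exact .zero Set.inter_subset_left h.one_le h.nonneg
  · by_cases hi : IsTouching (affineMaps ρ t) i
    · exact (h.separation i hi).right
    · rw [(h.zero i hi).2]
      exact .zero Set.inter_subset_left h.one_le h.nonneg

lemma right (h : IsEndDisplacement ρ t T η C ε L R) (j : Fin (m + 1)) :
    IsDisplacement T (T ∩ Set.Iic (ρ j + t j)) (ρ j + t j) η C ε (R j) := by
  refine Fin.lastCases ?_ (fun i => ?_) j
  · rw [h.last]
    exact .zero Set.inter_subset_left h.one_le h.nonneg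
  · by_cases hi : IsTouching (affineMaps ρ t) i
    · rw [isTouching_affineMaps.1 hi]
      exact (h.separation i hi).left
    · rw [(h.zero i hi).1]
      exact .zero Set.inter_subset_left h.one_le h.nonneg

lemma affineMaps_mem (hT : IsIntervalIFS ρ t T) (j : Fin (m + 1)) {x : ℝ} (hx : x ∈ T) :
    affineMaps ρ t j x ∈ T ∩ Set.Ici (t j) ∧ affineMaps ρ t j x ∈ T ∩ Set.Iic (ρ j + t j) := by
  have h1 := hT.isAttractor.mapsTo j x hx
  obtain ⟨h2, h3⟩ := hT.mem_Icc hx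
  refine ⟨⟨h1, ?_⟩, ⟨h1, ?_⟩⟩
  · have := mul_nonneg (hT.pos j).le h2
    simp only [affineMaps, Set.mem_Ici]
    linarith
  · have := mul_le_mul_of_nonneg_left h3 (hT.pos j).le
    simp only [affineMaps, Set.mem_Iic]
    linarith

lemma left_eq_zero (h : IsEndDisplacement ρ t T η C ε L R) {j : Fin (m + 1)} {v : ℝ} (hv : v ∈ T)
    (hlt : t j + ε < v) : L j v = 0 := by
  by_contra hne
  have hle : t j ≤ v := by linarith [h.nonneg]
  have := (abs_le.1 ((h.left j).supp v ⟨hv, hle⟩ hne)).2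
  linarith

lemma right_eq_zero (h : IsEndDisplacement ρ t T η C ε L R) {j : Fin (m + 1)} {v : ℝ} (hv : v ∈ T)
    (hlt : v < ρ j + t j - ε) : R j v = 0 := by
  by_contra hne
  have hle : v ≤ ρ j + t j := by linarith [h.nonneg]
  have := (abs_le.1 ((h.right j).supp v ⟨hv, hle⟩ hne)).1
  linarith

lemma left_or_right (h : IsEndDisplacement ρ t T η C ε L R) (hT : IsIntervalIFS ρ t T)
    (j : Fin (m + 1)) {v : ℝ} (hv : v ∈ T) : L j v = 0 ∨ R j v = 0 := by
  have h1 := h.small j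
  have h2 := hT.pos j
  have h3 := h.nonneg
  rcases le_or_gt v (t j + ε) with hle | hgt
  · exact Or.inr (h.right_eq_zero hv (by linarith))
  · exact Or.inl (h.left_eq_zero hv hgt)

lemma abs_displacedMaps_sub_le (h : IsEndDisplacement ρ t T η C ε L R)
    (hT : IsIntervalIFS ρ t T) (j : Fin (m + 1)) {x : ℝ} (hx : x ∈ T) :
    |displacedMaps ρ t L R j x - affineMaps ρ t j x| ≤ ε := by
  obtain ⟨hl, hr⟩ := affineMaps_mem hT j hx
  have h1 := (h.left j).small _ hl
  have h2 := (h.right j).small _ hr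
  unfold displacedMaps
  rcases h.left_or_right hT j hl.1 with h0 | h0
  · rw [h0, add_zero, add_sub_cancel_left]
    exact h2
  · rw [h0, add_zero, add_sub_cancel_left]
    exact h1

lemma displacedMaps_mem (h : IsEndDisplacement ρ t T η C ε L R)
    (hT : IsIntervalIFS ρ t T) (j : Fin (m + 1)) {x : ℝ} (hx : x ∈ T) :
    displacedMaps ρ t L R j x ∈ T := by
  obtain ⟨hl, hr⟩ := affineMaps_mem hT j hx
  unfold displacedMaps
  rcases h.left_or_right hT j hl.1 with h0 | h0
  · rw [h0, add_zero]
    exact (h.right j).mem _ hr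
  · rw [h0, add_zero]
    exact (h.left j).mem _ hl

lemma exists_displacedMaps_eq (h : IsEndDisplacement ρ t T η C ε L R)
    (hT : IsIntervalIFS ρ t T) (hε : 0 < ε) {y : ℝ} (hy : y ∈ T) :
    ∃ j, ∃ x ∈ T, displacedMaps ρ t L R j x = y := by
  -- points of the intervals are images of points of `T` under the affine maps
  have hpre : ∀ j, ∀ v ∈ T, t j ≤ v → v ≤ ρ j + t j → ∃ x ∈ T, affineMaps ρ t j x = v := by
    intro j v hv h1 h2
    have hj := hT.pos j
    have heq : affineMaps ρ t j ((v - t j) / ρ j) = v := by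
      unfold affineMaps
      rw [mul_div_cancel₀ _ hj.ne']
      ring
    refine ⟨(v - t j) / ρ j, ?_, heq⟩
    rwa [← hT.affineMaps_mem_iff j (div_nonneg (by linarith) hj.le)
      ((div_le_one hj).2 (by linarith)), heq]
  by_cases hnear : ∃ i : Fin m, IsTouching (affineMaps ρ t) i ∧ |y - t i.succ| ≤ ε
  · obtain ⟨i, hi, hd⟩ := hnear
    obtain ⟨hd1, hd2⟩ := abs_le.1 hd
    have hsep := h.separation i hi
    rw [isTouching_affineMaps] at hi
    have hs1 := h.small i.castSucc
    have hs2 := h.small i.succ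
    rcases hsep.cover y hy with ⟨v, hv, hvy⟩ | ⟨v, hv, hvy⟩
    · obtain ⟨h1, h2⟩ := abs_le.1 (hsep.left.small v hv)
      have hvle : v ≤ t i.succ := hv.2
      obtain ⟨x, hx, rfl⟩ := hpre i.castSucc v hv.1 (by linarith) (by linarith)
      refine ⟨i.castSucc, x, hx, ?_⟩
      rw [displacedMaps, h.left_eq_zero hv.1 (by linarith), add_zero, hvy]
    · obtain ⟨h1, h2⟩ := abs_le.1 (hsep.right.small v hv)
      have hvge : t i.succ ≤ v := hv.2
      obtain ⟨x, hx, rfl⟩ := hpre i.succ v hv.1 hvge (by linarith)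
      refine ⟨i.succ, x, hx, ?_⟩
      rw [displacedMaps, h.right_eq_zero hv.1 (by linarith), add_zero, hvy]
  · obtain ⟨j, x, hx, rfl⟩ := hT.isAttractor.exists_preimage hy
    refine ⟨j, x, hx, ?_⟩
    obtain ⟨hl, hr⟩ := affineMaps_mem hT j hx
    have hL : L j (affineMaps ρ t j x) = 0 := by
      by_contra hne
      have hd := (h.left j).supp _ hl hne
      obtain rfl | ⟨i, rfl⟩ := Fin.eq_zero_or_eq_succ j
      · exact hne (by rw [h.first]; rfl)
      · by_cases hi : IsTouching (affineMaps ρ t) i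
        · exact hnear ⟨i, hi, hd⟩
        · exact hne (by rw [(h.zero i hi).2]; rfl)
    have hR : R j (affineMaps ρ t j x) = 0 := by
      by_contra hne
      have hd := (h.right j).supp _ hr hne
      obtain ⟨i, rfl⟩ | rfl := Fin.eq_castSucc_or_eq_last j
      · by_cases hi : IsTouching (affineMaps ρ t) i
        · rw [isTouching_affineMaps.1 hi] at hd
          exact hnear ⟨i, hi, hd⟩
        · exact hne (by rw [(h.zero i hi).1]; rfl)
      · exact hne (by rw [h.last]; rfl)
    rw [displacedMaps, hL, hR, add_zero, add_zero]

lemma displacedMaps_ne (h : IsEndDisplacement ρ t T η C ε L R)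
    (hT : IsIntervalIFS ρ t T) (hε : 0 < ε) {j k : Fin (m + 1)} (hjk : j < k) {x y : ℝ}
    (hx : x ∈ T) (hy : y ∈ T) : displacedMaps ρ t L R j x ≠ displacedMaps ρ t L R k y := by
  intro heq
  obtain ⟨hxl, hxr⟩ := affineMaps_mem hT j hx
  obtain ⟨hyl, hyr⟩ := affineMaps_mem hT k hy
  obtain ⟨h1, h2⟩ := abs_le.1 (h.abs_displacedMaps_sub_le hT j hx)
  obtain ⟨h3, h4⟩ := abs_le.1 (h.abs_displacedMaps_sub_le hT k hy)
  have h5 : affineMaps ρ t j x ≤ ρ j + t j := hxr.2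
  have h6 : t k ≤ affineMaps ρ t k y := hyl.2
  obtain ⟨i, rfl⟩ := Fin.exists_castSucc_eq.2 ((Fin.le_last k).trans_lt' hjk).ne
  have hk : k = i.succ := by
    by_contra hne
    have hlt : i.succ < k :=
      lt_of_le_of_ne (Fin.castSucc_lt_iff_succ_le.1 hjk) (Ne.symm hne)
    have := hT.le_of_lt hlt
    have := hT.step i
    have := h.small i.succ
    linarith
  subst hk
  have hs1 := h.small i.castSucc
  have hs2 := h.small i.succ
  have hstep := hT.step i
  unfold displacedMaps at heq h1 h2 h3 h4
  have hL : L i.castSucc (affineMaps ρ t i.castSucc x) = 0 := h.left_eq_zero hxl.1 (by linarith)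
  have hR : R i.succ (affineMaps ρ t i.succ y) = 0 := h.right_eq_zero hyl.1 (by linarith)
  rw [hL, hR, add_zero, add_zero] at heq
  by_cases hi : IsTouching (affineMaps ρ t) i
  · rw [isTouching_affineMaps.1 hi] at hxr
    exact (h.separation i hi).disjoint _ hxr _ hyl heq
  · rw [(h.zero i hi).1, (h.zero i hi).2, Pi.zero_apply, Pi.zero_apply, add_zero, add_zero] at heq
    exact hi (isTouching_affineMaps.2 (by linarith))

lemma isAttractor (h : IsEndDisplacement ρ t T η C ε L R) (hT : IsIntervalIFS ρ t T)
    (hε : 0 < ε) : IsAttractor (displacedMaps ρ t L R) T := by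
  refine ⟨hT.isAttractor.nonempty, hT.isAttractor.isCompact, Set.Subset.antisymm ?_ ?_⟩
  · refine Set.iUnion_subset fun j => ?_
    rintro _ ⟨x, hx, rfl⟩
    exact h.displacedMaps_mem hT j hx
  · intro y hy
    obtain ⟨j, x, hx, hxy⟩ := h.exists_displacedMaps_eq hT hε hy
    exact Set.mem_iUnion.2 ⟨j, x, hx, hxy⟩

lemma disjoint_image (h : IsEndDisplacement ρ t T η C ε L R) (hT : IsIntervalIFS ρ t T)
    (hε : 0 < ε) {j k : Fin (m + 1)} (hjk : j ≠ k) :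
    Disjoint (displacedMaps ρ t L R j '' T) (displacedMaps ρ t L R k '' T) := by
  rw [Set.disjoint_left]
  rintro _ ⟨x, hx, rfl⟩ ⟨y, hy, heq⟩
  rcases lt_or_gt_of_ne hjk with hlt | hgt
  · exact h.displacedMaps_ne hT hε hlt hx hy heq.symm
  · exact h.displacedMaps_ne hT hε hgt hy hx heq

lemma abs_affineMaps_sub (hT : IsIntervalIFS ρ t T) (j : Fin (m + 1)) (x y : ℝ) :
    |affineMaps ρ t j x - affineMaps ρ t j y| = ρ j * |x - y| := by
  unfold affineMaps
  rw [add_sub_add_right_eq_sub, ← mul_sub, abs_mul, abs_of_pos (hT.pos j)]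

lemma displacedMaps_bilip (h : IsEndDisplacement ρ t T η C ε L R) (hT : IsIntervalIFS ρ t T)
    (hC : 2 ≤ C) (j : Fin (m + 1)) {x y : ℝ} (hx : x ∈ T) (hy : y ∈ T) :
    ρ j * |x - y| ≤ C * |displacedMaps ρ t L R j x - displacedMaps ρ t L R j y| ∧
      |displacedMaps ρ t L R j x - displacedMaps ρ t L R j y| ≤ C * (ρ j * |x - y|) := by
  obtain ⟨hxl, hxr⟩ := affineMaps_mem hT j hx
  obtain ⟨hyl, hyr⟩ := affineMaps_mem hT j hy
  have hdx := h.abs_displacedMaps_sub_le hT j hx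
  have hdy := h.abs_displacedMaps_sub_le hT j hy
  have hs := h.small j
  rw [← abs_affineMaps_sub hT]
  rcases lt_or_ge |affineMaps ρ t j x - affineMaps ρ t j y| (8 * ε) with hlt | hge
  · -- two points that are this close are displaced near at most one of the two ends
    obtain ⟨h1, h2⟩ := abs_lt.1 hlt
    have hcase : (L j (affineMaps ρ t j x) = 0 ∧ L j (affineMaps ρ t j y) = 0) ∨
        (R j (affineMaps ρ t j x) = 0 ∧ R j (affineMaps ρ t j y) = 0) := by
      rcases le_or_gt (affineMaps ρ t j x) (t j + 16 * ε) with hle | hgt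
      · exact Or.inr ⟨h.right_eq_zero hxl.1 (by linarith), h.right_eq_zero hyl.1 (by linarith)⟩
      · exact Or.inl ⟨h.left_eq_zero hxl.1 (by linarith), h.left_eq_zero hyl.1 (by linarith)⟩
    unfold displacedMaps
    rcases hcase with ⟨h3, h4⟩ | ⟨h3, h4⟩
    · rw [h3, h4, add_zero, add_zero]
      exact (h.right j).bilip _ hxr _ hyr
    · rw [h3, h4, add_zero, add_zero]
      exact (h.left j).bilip _ hxl _ hyl
  · set a := affineMaps ρ t j x
    set b := affineMaps ρ t j y
    set a' := displacedMaps ρ t L R j x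
    set b' := displacedMaps ρ t L R j y
    have h1 : |a - b| ≤ |a' - b'| + 2 * ε := by
      have : a - b = (a' - b') + (-(a' - a) + (b' - b)) := by ring
      rw [this]
      refine (abs_add_le _ _).trans ?_
      have := abs_add_le (-(a' - a)) (b' - b)
      rw [abs_neg] at this
      linarith
    have h2 : |a' - b'| ≤ |a - b| + 2 * ε := by
      have : a' - b' = (a - b) + ((a' - a) + -(b' - b)) := by ring
      rw [this]
      refine (abs_add_le _ _).trans ?_
      have := abs_add_le (a' - a) (-(b' - b))
      rw [abs_neg] at this
      linarith
    have h3 := mul_le_mul_of_nonneg_right hC (abs_nonneg (a' - b'))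
    have h4 := mul_le_mul_of_nonneg_right hC (abs_nonneg (a - b))
    have h5 := h.nonneg
    exact ⟨by linarith, by linarith⟩

lemma displacedMaps_contract (h : IsEndDisplacement ρ t T η C ε L R) (hT : IsIntervalIFS ρ t T)
    (j : Fin (m + 1)) {x y : ℝ} (hx : x ∈ T) (hy : y ∈ T) :
    |displacedMaps ρ t L R j x - displacedMaps ρ t L R j y| ≤ ρ j * |x - y| + 2 * ε := by
  have hdx := h.abs_displacedMaps_sub_le hT j hx
  have hdy := h.abs_displacedMaps_sub_le hT j hy
  rw [← abs_affineMaps_sub hT]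
  set a := affineMaps ρ t j x
  set b := affineMaps ρ t j y
  set a' := displacedMaps ρ t L R j x
  set b' := displacedMaps ρ t L R j y
  have : a' - b' = (a - b) + ((a' - a) + -(b' - b)) := by ring
  rw [this]
  refine (abs_add_le _ _).trans ?_
  have := abs_add_le (a' - a) (-(b' - b))
  rw [abs_neg] at this
  linarith

lemma displacedMaps_loc (h : IsEndDisplacement ρ t T η C ε L R) (hT : IsIntervalIFS ρ t T)
    (hη : 0 < η) (j : Fin (m + 1)) {x y : ℝ} (hx : x ∈ T) (hy : y ∈ T)
    (hd : |x - y| < η * min x (1 - x)) :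
    |displacedMaps ρ t L R j x - displacedMaps ρ t L R j y| = ρ j * |x - y| := by
  obtain ⟨hxl, hxr⟩ := affineMaps_mem hT j hx
  obtain ⟨hyl, hyr⟩ := affineMaps_mem hT j hy
  obtain ⟨hx0, hx1⟩ := hT.mem_Icc hx
  have hj := hT.pos j
  have hd1 := mul_lt_mul_of_pos_left hd hj
  have h1 := mul_le_mul_of_nonneg_left (min_le_left x (1 - x)) (mul_nonneg hj.le hη.le)
  have h2 := mul_le_mul_of_nonneg_left (min_le_right x (1 - x)) (mul_nonneg hj.le hη.le)
  have hL : L j (affineMaps ρ t j x) = L j (affineMaps ρ t j y) := by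
    refine (h.left j).loc _ hxl _ hyl ?_
    have : |affineMaps ρ t j x - t j| = ρ j * x := by
      rw [affineMaps, add_sub_cancel_right, abs_of_nonneg (mul_nonneg hj.le hx0)]
    rw [abs_affineMaps_sub hT, this]
    linarith
  have hR : R j (affineMaps ρ t j x) = R j (affineMaps ρ t j y) := by
    refine (h.right j).loc _ hxr _ hyr ?_
    have : |affineMaps ρ t j x - (ρ j + t j)| = ρ j * (1 - x) := by
      have heq : affineMaps ρ t j x - (ρ j + t j) = -(ρ j * (1 - x)) := by
        unfold affineMaps
        ring
      rw [heq, abs_neg, abs_of_nonneg (mul_nonneg hj.le (by linarith))]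
    rw [abs_affineMaps_sub hT, this]
    linarith
  rw [displacedMaps, displacedMaps, hL, hR, ← abs_affineMaps_sub hT]
  congr 1
  ring

/-- If the image of `x` is close to an end of `[0, 1]`, then this end is an end of the interval of
the letter, and there is no displacement near `x`. -/
lemma displacedMaps_near_end (h : IsEndDisplacement ρ t T η C ε L R) (hT : IsIntervalIFS ρ t T)
    {c : ℝ} (hc : ∀ j, 4 * c ≤ ρ j) (j : Fin (m + 1)) {x : ℝ} (hx : x ∈ T)
    (hlt : min (displacedMaps ρ t L R j x) (1 - displacedMaps ρ t L R j x) < c) :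
    ρ j * min x (1 - x) ≤ min (displacedMaps ρ t L R j x) (1 - displacedMaps ρ t L R j x) ∧
      ∀ y ∈ T, |x - y| ≤ 1 / 8 →
        |displacedMaps ρ t L R j x - displacedMaps ρ t L R j y| = ρ j * |x - y| := by
  obtain ⟨hx0, hx1⟩ := hT.mem_Icc hx
  obtain ⟨h1, h2⟩ := abs_le.1 (h.abs_displacedMaps_sub_le hT j hx)
  have hs := h.small j
  have hcj := hc j
  have hj := hT.pos j
  have hj1 := hT.lt_one j
  have hε := h.nonneg
  rcases min_lt_iff.1 hlt with hlt | hlt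
  · obtain rfl | ⟨i, rfl⟩ := Fin.eq_zero_or_eq_succ j
    · have hsmall : ∀ y ∈ T, y < 1 / 2 → displacedMaps ρ t L R 0 y = ρ 0 * y := by
        intro y hy hy2
        have h3 := mul_lt_mul_of_pos_left hy2 hj
        have h4 : R 0 (affineMaps ρ t 0 y) = 0 := by
          refine h.right_eq_zero (hT.isAttractor.mapsTo 0 y hy) ?_
          simp only [affineMaps, hT.left_end]
          linarith
        rw [displacedMaps, h.first, h4, Pi.zero_apply, add_zero, add_zero, affineMaps, hT.left_end,
          add_zero]
      have hx2 : x < 3 / 8 := by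
        rw [affineMaps, hT.left_end] at h1
        by_contra hn
        rw [not_lt] at hn
        have := mul_le_mul_of_nonneg_left hn hj.le
        linarith
      rw [hsmall x hx (by linarith)]
      refine ⟨le_min ?_ ?_, fun y hy hxy => ?_⟩
      · exact mul_le_mul_of_nonneg_left (min_le_left _ _) hj.le
      · have h3 := mul_le_mul_of_nonneg_left (min_le_right x (1 - x)) hj.le
        linarith
      · rw [hsmall y hy (by linarith [(abs_le.1 hxy).1]), ← mul_sub, abs_mul, abs_of_pos hj]
    · exfalso
      have h3 := hT.le_of_lt (Fin.succ_pos i)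
      rw [hT.left_end] at h3
      have h4 := hc 0
      have h5 := h.small 0
      have h6 := mul_nonneg hj.le hx0
      unfold affineMaps at h1
      linarith [hT.pos 0]
  · obtain ⟨i, rfl⟩ | rfl := Fin.eq_castSucc_or_eq_last j
    · exfalso
      have h3 := hT.le_of_lt (Fin.castSucc_lt_last i)
      have h4 := hc (Fin.last m)
      have h5 := h.small (Fin.last m)
      have h6 := mul_le_mul_of_nonneg_left hx1 hj.le
      unfold affineMaps at h2
      linarith [hT.pos (Fin.last m), hT.right_end]
    · have hend := hT.right_end
      have hlarge : ∀ y ∈ T, 1 / 2 < y →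
          displacedMaps ρ t L R (Fin.last m) y = 1 - ρ (Fin.last m) * (1 - y) := by
        intro y hy hy2
        have h3 := mul_lt_mul_of_pos_left hy2 hj
        have h4 : L (Fin.last m) (affineMaps ρ t (Fin.last m) y) = 0 := by
          refine h.left_eq_zero (hT.isAttractor.mapsTo _ y hy) ?_
          simp only [affineMaps]
          linarith
        rw [displacedMaps, h.last, h4, Pi.zero_apply, add_zero, add_zero, affineMaps]
        linarith
      have hx2 : 5 / 8 < x := by
        unfold affineMaps at h2
        by_contra hn
        rw [not_lt] at hn
        have := mul_le_mul_of_nonneg_left hn hj.le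
        linarith
      rw [hlarge x hx (by linarith)]
      refine ⟨le_min ?_ ?_, fun y hy hxy => ?_⟩
      · have h3 := mul_le_mul_of_nonneg_left (min_le_left x (1 - x)) hj.le
        linarith
      · have h3 := mul_le_mul_of_nonneg_left (min_le_right x (1 - x)) hj.le
        linarith
      · rw [hlarge y hy (by linarith [(abs_le.1 hxy).2])]
        have : 1 - ρ (Fin.last m) * (1 - x) - (1 - ρ (Fin.last m) * (1 - y)) =
          ρ (Fin.last m) * (x - y) := by ring
        rw [this, abs_mul, abs_of_pos hj]

end IsEndDisplacement

/-- The attractor is coded by suitable displaced maps. -/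
theorem IsIntervalIFS.exists_isBilipCoding {m : ℕ} {ρ t : Fin (m + 1) → ℝ} {T : Set ℝ}
    (hT : IsIntervalIFS ρ t T)
    (hsep : ∀ i : Fin m, IsTouching (affineMaps ρ t) i →
      ∃ η C : ℝ, 0 < η ∧ ∀ ε > 0, ∃ sl sr, IsSeparation T (t i.succ) η C ε sl sr) :
    ∃ g, IsBilipCoding ρ g T := by
  classical
  -- constants that work for all touching letters
  obtain ⟨η, C, hη, hC, hsep⟩ : ∃ η C : ℝ, 0 < η ∧ 2 ≤ C ∧
      ∀ i : Fin m, IsTouching (affineMaps ρ t) i → ∀ ε > 0, ∃ sl sr,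
        IsSeparation T (t i.succ) η C ε sl sr := by
    have hsep' : ∀ i : Fin m, ∃ η C : ℝ, 0 < η ∧ (IsTouching (affineMaps ρ t) i →
        ∀ ε > 0, ∃ sl sr, IsSeparation T (t i.succ) η C ε sl sr) := fun i => by
      by_cases hi : IsTouching (affineMaps ρ t) i
      · obtain ⟨η, C, h1, h2⟩ := hsep i hi
        exact ⟨η, C, h1, fun _ => h2⟩
      · exact ⟨1, 1, one_pos, fun h => absurd h hi⟩
    choose η C hη hs using hsep'
    rcases isEmpty_or_nonempty (Fin m) with hm | hm
    · exact ⟨1, 2, one_pos, le_rfl, fun i => hm.elim i⟩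
    obtain ⟨i₁, h1⟩ := Finite.exists_min η
    obtain ⟨i₂, h2⟩ := Finite.exists_max C
    refine ⟨η i₁, max 2 (C i₂), hη i₁, le_max_left _ _, fun i hi ε hε => ?_⟩
    obtain ⟨sl, sr, h3⟩ := hs i hi ε hε
    exact ⟨sl, sr, h3.mono (h1 i) ((h2 i).trans (le_max_right _ _)) le_rfl⟩
  obtain ⟨j₁, hmin⟩ := Finite.exists_min ρ
  obtain ⟨j₂, hmax⟩ := Finite.exists_max ρ
  have hμ := hT.pos j₁
  have hρ1 := hT.lt_one j₂
  set c := ρ j₁ / 4 with hc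
  set δ := min (1 / 8) (η * c / (2 * C)) with hδ
  have hδ0 : 0 < δ := lt_min (by norm_num) (by positivity)
  have hCδ : C * δ < η * c := by
    have h1 : δ ≤ η * c / (2 * C) := min_le_right _ _
    rw [le_div_iff₀ (by linarith)] at h1
    have : 0 < η * c := by positivity
    linarith
  set ε := min (ρ j₁ / 32) ((1 - ρ j₂) * δ / 4) with hε
  have hε0 : 0 < ε := lt_min (by linarith) (div_pos (mul_pos (by linarith) hδ0) (by norm_num))
  have hloc : ∀ i : Fin m, ∃ sl sr : ℝ → ℝ, (IsTouching (affineMaps ρ t) i →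
      IsSeparation T (t i.succ) η C ε sl sr) ∧
        (¬ IsTouching (affineMaps ρ t) i → sl = 0 ∧ sr = 0) := fun i => by
    by_cases hi : IsTouching (affineMaps ρ t) i
    · obtain ⟨sl, sr, h⟩ := hsep i hi ε hε0
      exact ⟨sl, sr, fun _ => h, fun h => absurd hi h⟩
    · exact ⟨0, 0, fun h => absurd h hi, fun _ => ⟨rfl, rfl⟩⟩
  choose sl sr hs1 hs0 using hloc
  set L : Fin (m + 1) → ℝ → ℝ := Fin.cons 0 sr with hL
  set R : Fin (m + 1) → ℝ → ℝ := Fin.snoc sl 0 with hR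
  have hLs : ∀ i : Fin m, L i.succ = sr i := fun i => by rw [hL, Fin.cons_succ]
  have hRs : ∀ i : Fin m, R i.castSucc = sl i := fun i => by
    rw [hR]
    exact Fin.snoc_castSucc (α := fun _ => ℝ → ℝ) _ _ _
  have hend : IsEndDisplacement ρ t T η C ε L R :=
    { one_le := by linarith
      nonneg := hε0.le
      small := fun j => by
        have h1 : ε ≤ ρ j₁ / 32 := min_le_left _ _
        linarith [hmin j]
      first := Fin.cons_zero _ _
      last := Fin.snoc_last (α := fun _ => ℝ → ℝ) _ _
      separation := fun i hi => by
        rw [hLs, hRs]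
        exact hs1 i hi
      zero := fun i hi => by
        rw [hLs, hRs]
        exact hs0 i hi }
  refine ⟨displacedMaps ρ t L R, hend.isAttractor hT hε0,
    fun j k hjk => hend.disjoint_image hT hε0 hjk, ?_⟩
  refine wordMap_distortion (φ := fun x => min x (1 - x)) (η := η) (c := c) (C := C) (δ := δ)
    (R := ρ j₂) hT.pos hT.lt_one (hT.pos j₂).le hρ1 ?_ (hend.isAttractor hT hε0).mapsTo hη
    (by linarith) hδ0 hCδ (fun i x hx y hy hd => hend.displacedMaps_loc hT hη i hx hy hd) ?_
    (fun i x hx y hy => hend.displacedMaps_bilip hT hC i hx hy) ?_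
  · intro x hx y hy
    obtain ⟨h1, h2⟩ := hT.mem_Icc hx
    obtain ⟨h3, h4⟩ := hT.mem_Icc hy
    exact abs_le.2 ⟨by linarith, by linarith⟩
  · intro i x hx hlt
    obtain ⟨h1, h2⟩ := hend.displacedMaps_near_end hT (c := c)
      (fun j => by rw [hc]; linarith [hmin j]) i hx hlt
    exact ⟨h1, fun y hy hxy => h2 y hy (hxy.trans (min_le_left _ _))⟩
  · intro i x hx y hy
    refine (hend.displacedMaps_contract hT i hx hy).trans ?_
    have h1 := mul_le_mul_of_nonneg_right (hmax i) (abs_nonneg (x - y))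
    have h2 : ε ≤ (1 - ρ j₂) * δ / 4 := min_le_right _ _
    linarith

end TouchingIFS

theorem theorem1p3 (m : ℕ) (hm : 3 ≤ m + 1) (ρ : Fin (m + 1) → ℝ)
    (hρ : TouchingIFS.IsContractionVector ρ)
    (t : Fin (m + 1) → ℝ)
    (hψ : TouchingIFS.IsTouchingIFS (TouchingIFS.affineMaps ρ t))
    (T : Set ℝ) (hT : TouchingIFS.IsAttractor (TouchingIFS.affineMaps ρ t) T)
    (D : Set ℝ) (hD : D ∈ TouchingIFS.dustLike ρ)
    (hlog : ∃ r : ℚ, Real.log (ρ 0) / Real.log (ρ (Fin.last m)) = (r : ℝ))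
    (hsub : ∀ i : Fin m, TouchingIFS.IsTouching (TouchingIFS.affineMaps ρ t) i →
      TouchingIFS.Substitutable (TouchingIFS.affineMaps ρ t) T i) :
    TouchingIFS.LipschitzEquivalent D T := by
  have hI : TouchingIFS.IsIntervalIFS ρ t T :=
    { pos := hρ.pos
      lt_one := hρ.lt_one
      step := fun i => by simpa [TouchingIFS.affineMaps] using hψ.ordered i
      left_end := by simpa [TouchingIFS.affineMaps] using hψ.left_end
      right_end := by simpa [TouchingIFS.affineMaps] using hψ.right_end
      isAttractor := hT }
  obtain ⟨g, hg⟩ := hI.exists_isBilipCoding fun i hi => hI.exists_isSeparation hlog hi (hsub i hi)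
  obtain ⟨φ, hφ, hφD, hdisj⟩ := hD
  exact (TouchingIFS.IsBilipCoding.of_similitudes hφ hφD hdisj).lipschitzEquivalent hg hρ.pos
    hρ.lt_one
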